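/- Let $G$ be a simple graph on a finite non-empty vertex set $\mathcal V$ with $N$ vertices. For $i\in\mathcal V$ let $\Xi(i)$ be the set consisting of $i$ and its neighbours, $\mathcal N_i=|\Xi(i)|$ and $d_i=\mathcal N_i/N$. A graph sample is a family $\mathcal Z=(Z_i)_{i\in\mathcal V}$ of feature–label pairs $Z_i=(X_i,Y_i)$; it induces for each vertex $j$ the pair $(\mathcal T_j,Y_j)$ with $\mathcal T_j=(X_k)_{k\in\Xi(j)}$. A hypothesis $h$ predicts the label of vertex $j$ from $\mathcal T_j$ (the prediction rule may depend on $j$), and the loss satisfies $0\le L\le B_L$. Put $\widehat R_{\mathcal Z}(h)=\frac1N\sum_{j\in\mathcal V}L(h(\mathcal T_j),Y_j)$. Let $\mathbb D$ be a probability law of graph samples that satisfies Dobrushin's condition with coefficient $\alpha<1$: for some versions of the conditional laws of $Z_i$ given $(Z_k)_{k\ne i}$, defined at every configuration, one has $\sum_{j\neq i} I_{j\to i}\le\alpha$ for every $i$, where $I_{j\to i}$ is the supremum of the total variation distance between the conditional laws of $Z_i$ given two configurations of the other coordinates that differ at most in coordinate $j$. Let $\mathcal Z_1^m=(\mathcal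 Z_1,\dots,\mathcal Z_m)$, $m\ge1$, be independent with law $\mathbb D$, let $\mathcal A$ be an algorithm that returns a hypothesis $h_{\mathcal Z_1^m}$, and put $\widehat R_{\mathcal Z_1^m}(h)=\frac1m\sum_{i=1}^m\widehat R_{\mathcal Z_i}(h)$ and $R(h)=\mathbb E_{\mathcal Z\sim\mathbb D}[\widehat R_{\mathcal Z}(h)]$. Assume that $\mathcal A$ is uniformly stable with parameter $\mu$: whenever two collections $\mathcal Z_1^m$, $\mathcal Z_1^{\prime m}$ differ at most in one vertex of one graph sample, $|L(h_{\mathcal Z_1^m}(\mathcal T_j),Y_j)-L(h_{\mathcal Z_1^{\prime m}}(\mathcal T_j),Y_j)|\le\mu$ for every graph sample inducing $(\mathcal T_j,Y_j)_j$ and every $j\in\mathcal V$. Then for every $\delta\in(0,1)$, with probability at least $1-\delta$, $$R(h_{\mathcal Z_1^m})-\widehat R_{\mathcal Z_1^m}(h_{\mathcal Z_1^m})\le N\mu+\sqrt{\frac{2m\sum_{i\in\mathcal V}\Big(\big(2-\frac{d_i}{m}\big)\mu+\frac{\mathcal N_iB_L}{mN}\Big)^2\log\frac1\delta}{1-\alpha}},$$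 and, also with probability at least $1-\delta$, the same upper bound holds for $\widehat R_{\mathcal Z_1^m}(h_{\mathcal Z_1^m})-R(h_{\mathcal Z_1^m})$. -/

import Mathlib

open MeasureTheory ProbabilityTheory

noncomputable section

/-- Total variation distance `sup_A |P(A) - Q(A)|`, over measurable sets `A`. -/
def tvDistance {Z : Type*} [MeasurableSpace Z] (P Q : Measure Z) : ℝ :=
  sSup {r : ℝ | ∃ A : Set Z, MeasurableSet A ∧ r = |P.real A - Q.real A|}

/-- The influence of coordinate `j` on coordinate `i`, for a conditional law `κ` of coordinate `i`
given all the other coordinates: the largest total variation distance between two conditional laws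
whose conditioning configurations differ at most in coordinate `j`. -/
def influence {V Z : Type*} [MeasurableSpace Z] {i : V}
    (κ : Kernel ({k : V // k ≠ i} → Z) Z) (j : {k : V // k ≠ i}) : ℝ :=
  sSup {r : ℝ | ∃ x y : {k : V // k ≠ i} → Z,
    (∀ k, k ≠ j → x k = y k) ∧ r = tvDistance (κ x) (κ y)}

open Classical in
/-- Dobrushin's condition with coefficient `α` for a law `D` on `V → Z`: `α < 1`, and there are
versions `κ i` of the conditional law of coordinate `i` given the others (defined at every
configuration) such that the total influence on each coordinate is at most `α`. -/
def DobrushinCondition {V Z : Type*} [Fintype V] [MeasurableSpace Z]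
    (D : Measure (V → Z)) (α : ℝ) : Prop :=
  α < 1 ∧ ∃ κ : ∀ i : V, Kernel ({k : V // k ≠ i} → Z) Z,
    (∀ i, IsMarkovKernel (κ i)) ∧
    (∀ i, HasCondDistrib (fun z : V → Z => z i)
      (fun (z : V → Z) (k : {k : V // k ≠ i}) => z k) (κ i) D) ∧
    ∀ i, ∑ j : {k : V // k ≠ i}, influence (κ i) j ≤ α

open Classical in
/-- The neighbourhood of a vertex, the vertex itself included. Every reflexive and symmetric
system of neighbourhoods on `V` (for instance `K`-hop neighbourhoods) arises so from a graph. -/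
def nbhd {V : Type*} [Fintype V] (G : SimpleGraph V) (i : V) : Finset V :=
  Finset.univ.filter fun j => j = i ∨ G.Adj i j

/-- The size of the neighbourhood of `i`. -/
def nbhdCard {V : Type*} [Fintype V] (G : SimpleGraph V) (i : V) : ℕ := (nbhd G i).card

/-- The relative size of the neighbourhood of `i`. -/
def nbhdDensity {V : Type*} [Fintype V] (G : SimpleGraph V) (i : V) : ℝ :=
  (nbhdCard G i : ℝ) / (Fintype.card V : ℝ)

/-- The input attached to vertex `j`: the features of all vertices in its neighbourhood. -/
def nodeInput {V X Y : Type*} [Fintype V] (G : SimpleGraph V) (z : V → X × Y) (j : V) :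
    nbhd G j → X :=
  fun k => (z k).1

/-- A hypothesis predicts the label of each vertex from the features in its neighbourhood. -/
abbrev Hypothesis {V : Type*} [Fintype V] (G : SimpleGraph V) (X W : Type*) :=
  ∀ j : V, (nbhd G j → X) → W

/-- A learning algorithm on `m` graph samples. -/
abbrev Algorithm {V : Type*} [Fintype V] (G : SimpleGraph V) (X Y W : Type*) (m : ℕ) :=
  (Fin m → V → X × Y) → Hypothesis G X W

/-- The loss of a hypothesis at vertex `j` of a graph sample `z`. -/
def nodeLoss {V X Y W : Type*} [Fintype V] (G : SimpleGraph V) (L : W → Y → ℝ)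
    (h : Hypothesis G X W) (z : V → X × Y) (j : V) : ℝ :=
  L (h j (nodeInput G z j)) (z j).2

/-- The empirical risk on one graph sample. -/
def graphRisk {V X Y W : Type*} [Fintype V] (G : SimpleGraph V) (L : W → Y → ℝ)
    (h : Hypothesis G X W) (z : V → X × Y) : ℝ :=
  (1 / (Fintype.card V : ℝ)) * ∑ j, nodeLoss G L h z j

/-- The empirical risk on `m` graph samples. -/
def empiricalRisk {V X Y W : Type*} [Fintype V] (G : SimpleGraph V) (L : W → Y → ℝ) {m : ℕ}
    (h : Hypothesis G X W) (S : Fin m → V → X × Y) : ℝ :=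
  (1 / (m : ℝ)) * ∑ i, graphRisk G L h (S i)

/-- The risk: the expected empirical risk on a fresh graph sample. -/
def risk {V X Y W : Type*} [Fintype V] [MeasurableSpace X] [MeasurableSpace Y]
    (G : SimpleGraph V) (L : W → Y → ℝ) (D : Measure (V → X × Y)) (h : Hypothesis G X W) : ℝ :=
  ∫ z, graphRisk G L h z ∂D

/-- Uniform stability with parameter `μ`: if two collections of `m` graph samples differ at most in
one vertex of one sample, the losses of the returned hypotheses differ by at most `μ` at every
vertex of every test sample. -/
def UniformlyStable {V X Y W : Type*} [Fintype V] (G : SimpleGraph V) (L : W → Y → ℝ) {m : ℕ}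
    (A : Algorithm G X Y W m) (μ : ℝ) : Prop :=
  ∀ (S S' : Fin m → V → X × Y) (i₀ : Fin m) (k₀ : V),
    (∀ i k, ¬(i = i₀ ∧ k = k₀) → S i k = S' i k) →
    ∀ (z : V → X × Y) (j : V), |nodeLoss G L (A S) z j - nodeLoss G L (A S') z j| ≤ μ

/-- The deviation term, of Dobrushin type. -/
def deviation {V : Type*} [Fintype V] (G : SimpleGraph V) (m : ℕ) (μ B α δ : ℝ) : ℝ :=
  Real.sqrt (2 * m *
    (∑ i : V, ((2 - nbhdDensity G i / m) * μ
      + nbhdCard G i * B / (m * (Fintype.card V : ℝ))) ^ 2) * Real.log (1 / δ) / (1 - α))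

end

/-!
The gap `f S = R(A S) - R̂(A S)` is a function of the `m * |V|` vertex data. Exchanging one sample
for a fresh one shows that its mean is at most `|V| μ` in absolute value (`abs_integral_gap_le`),
and changing the data of vertex `i` in one sample moves it by at most
`c i = (2 - d i / m) μ + N i B / (m |V|)` (`abs_gap_update_sub_le`). The theorem is then
McDiarmid's inequality for a law satisfying Dobrushin's condition
(`IsGibbsSystem.integral_exp_sub_le`):
`log E exp (f - E f) ≤ (∑ c i ^ 2) / (2 (1 - α))`.

Only the row sums of the influence matrix `D` are bounded by `α`, so the comparison bound
`c ⬝ (1 - D)⁻¹ c` is not enough for non-constant `c`. The remedy is to integrate out the coordinates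
in a favourable order. The conditional expectation of `f` given all coordinates outside `S \ {j}`
has oscillation at most `c j + ∑ u i c i` in coordinate `j`, where `u` solves
`u i = D i j + ∑ D i k u k` on `S \ {j}`. Given a vector `r ≥ 1 + D r` on `S`, an averaging argument
provides `j ∈ S` with `1 + ∑ u i ≤ r j` (`exists_low_influence`). Then `r - r j u` satisfies the same
inequality on `S \ {j}`, and the Cauchy–Schwarz inequality gives
`(c j + ∑ u i c i) ^ 2 ≤ r j c j ^ 2 + ∑ r j u i c i ^ 2`. So `½ ∑ r i c i ^ 2`, which equals
`½ (∑ c i ^ 2) / (1 - α)` at the start, pays for all the martingale differences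
(`IsGibbsSystem.integral_mul_exp_le`).

The feature and label spaces are arbitrary measurable spaces, so regular conditional laws of several
coordinates need not exist. The conditional expectations are built as uniform limits of single-site
resamplings (`IsGibbsSystem.exists_condAverage`). The resulting functions are defined everywhere, and
fixing coordinate `j` at a reference point locates the conditional expectation in an interval of
length twice its oscillation. Hoeffding's lemma on that interval gives the constant of the theorem.
-/

/-! ### A two-point form of Hoeffding's lemma -/

lemma sinh_le_mul_exp_sq_div_six {w : ℝ} (hw : 0 ≤ w) :
    Real.sinh w ≤ w * Real.exp (w ^ 2 / 6) := by
  have h1 := Real.hasSum_sinh w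
  have h2 : HasSum (fun n : ℕ => w * ((w ^ 2 / 6) ^ n / (n.factorial : ℝ)))
      (w * Real.exp (w ^ 2 / 6)) := by
    rw [Real.exp_eq_exp_ℝ]
    exact (NormedSpace.expSeries_div_hasSum_exp (w ^ 2 / 6)).mul_left w
  refine hasSum_le (fun n => ?_) h1 h2
  have hfac : (6 : ℝ) ^ n * n.factorial ≤ ((2 * n + 1).factorial : ℝ) := by
    induction n with
    | zero => simp
    | succ k ih =>
      have : (2 * (k + 1) + 1).factorial = (2 * k + 3) * ((2 * k + 2) * (2 * k + 1).factorial) := by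
        rw [show 2 * (k + 1) + 1 = (2 * k + 2) + 1 by ring, Nat.factorial_succ,
          show 2 * k + 2 = (2 * k + 1) + 1 by ring, Nat.factorial_succ]
      rw [this, Nat.factorial_succ]
      push_cast
      have hk : (0 : ℝ) ≤ k := Nat.cast_nonneg k
      calc (6 : ℝ) ^ (k + 1) * ((k + 1) * k.factorial)
          = (6 * (k + 1)) * (6 ^ k * k.factorial) := by ring
        _ ≤ (6 * (k + 1)) * ((2 * k + 1).factorial : ℝ) := by gcongr
        _ ≤ ((2 * k + 3) * (2 * k + 2)) * ((2 * k + 1).factorial : ℝ) := by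
            gcongr ?_ * _
            nlinarith
        _ = _ := by ring
  have : w * ((w ^ 2 / 6) ^ n / (n.factorial : ℝ)) = w ^ (2 * n + 1) / (6 ^ n * n.factorial) := by
    rw [div_pow, ← pow_mul, pow_succ (n := 2 * n)]
    field_simp
  rw [this]
  gcongr

lemma sinh_le_mul_cosh {w : ℝ} (hw : 0 ≤ w) : Real.sinh w ≤ w * Real.cosh w := by
  have hd : ∀ x : ℝ, HasDerivAt (fun x => x * Real.cosh x - Real.sinh x) (x * Real.sinh x) x := by
    intro x
    convert! ((hasDerivAt_id x).mul (Real.hasDerivAt_cosh x)).sub (Real.hasDerivAt_sinh x) using 1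
    simp
  have hm : MonotoneOn (fun x => x * Real.cosh x - Real.sinh x) (Set.Ici 0) := by
    refine monotoneOn_of_deriv_nonneg (convex_Ici 0)
      (fun x _ => (hd x).continuousAt.continuousWithinAt)
      (fun x _ => (hd x).differentiableAt.differentiableWithinAt) fun x hx => ?_
    rw [interior_Ici, Set.mem_Ioi] at hx
    rw [(hd x).deriv]
    have := Real.sinh_nonneg_iff.2 hx.le
    positivity
  have := hm Set.self_mem_Ici hw hw
  simp at this
  linarith

lemma mul_cosh_le_mul_sinh {w : ℝ} (hw : 0 ≤ w) :
    w * Real.cosh w ≤ (1 + w ^ 2 / 3) * Real.sinh w := by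
  have hd : ∀ x : ℝ, HasDerivAt (fun x => (1 + x ^ 2 / 3) * Real.sinh x - x * Real.cosh x)
      (x / 3 * (x * Real.cosh x - Real.sinh x)) x := by
    intro x
    convert! (((((hasDerivAt_id x).pow 2).div_const 3).const_add 1).mul
      (Real.hasDerivAt_sinh x)).sub ((hasDerivAt_id x).mul (Real.hasDerivAt_cosh x)) using 1
    simp
    ring
  have hm : MonotoneOn (fun x => (1 + x ^ 2 / 3) * Real.sinh x - x * Real.cosh x) (Set.Ici 0) := by
    refine monotoneOn_of_deriv_nonneg (convex_Ici 0)
      (fun x _ => (hd x).continuousAt.continuousWithinAt)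
      (fun x _ => (hd x).differentiableAt.differentiableWithinAt) fun x hx => ?_
    rw [interior_Ici, Set.mem_Ioi] at hx
    rw [(hd x).deriv]
    have := sinh_le_mul_cosh hx.le
    exact mul_nonneg (by positivity) (by linarith)
  have := hm Set.self_mem_Ici hw hw
  simp at this
  linarith

/-- Hoeffding's lemma in linearised form: on `[-w, w]` the exponential lies below its chord
`cosh w + s u`, and the chord, at any real mean `m`, lies below `exp (m + w ^ 2 / 2)`. -/
lemma exists_chord_bound {w : ℝ} (hw : 0 ≤ w) :
    ∃ s : ℝ, (∀ u, |u| ≤ w → Real.exp u ≤ Real.cosh w + s * u) ∧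
      ∀ m, Real.cosh w + s * m ≤ Real.exp (m + w ^ 2 / 2) := by
  rcases hw.eq_or_lt with rfl | hw
  · refine ⟨1, fun u hu => ?_, fun m => ?_⟩
    · have : u = 0 := abs_nonpos_iff.1 hu
      simp [this]
    · have := Real.add_one_le_exp m
      simp
      linarith
  refine ⟨Real.sinh w / w, fun u hu => ?_, fun m => ?_⟩
  · obtain ⟨h1, h2⟩ := abs_le.1 hu
    have hc := convexOn_exp.2 (Set.mem_univ (-w)) (Set.mem_univ w)
      (show 0 ≤ (w - u) / (2 * w) by apply div_nonneg <;> linarith)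
      (show 0 ≤ (w + u) / (2 * w) by apply div_nonneg <;> linarith)
      (by field_simp; ring)
    simp only [smul_eq_mul] at hc
    have e1 : (w - u) / (2 * w) * -w + (w + u) / (2 * w) * w = u := by field_simp; ring
    rw [e1] at hc
    refine hc.trans (le_of_eq ?_)
    rw [Real.cosh_eq, Real.sinh_eq]
    field_simp
    ring
  · set s := Real.sinh w / w with hs
    have hs0 : 0 < s := div_pos (Real.sinh_pos_iff.2 hw) hw
    have hlog : Real.log s ≤ w ^ 2 / 6 := by
      rw [Real.log_le_iff_le_exp hs0, hs, div_le_iff₀ hw, mul_comm]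
      exact sinh_le_mul_exp_sq_div_six hw.le
    have hcosh : Real.cosh w ≤ s * (1 + w ^ 2 / 3) := by
      rw [hs, div_mul_eq_mul_div, le_div_iff₀ hw]
      linarith [mul_cosh_le_mul_sinh hw.le]
    -- The tangent line of the exponential parallel to the chord touches at height `s`.
    have htan := Real.add_one_le_exp (m + w ^ 2 / 2 - Real.log s)
    rw [Real.exp_sub, Real.exp_log hs0, le_div_iff₀ hs0] at htan
    nlinarith

/-! ### Choosing the coordinate to integrate last -/

/-- For a nonnegative matrix `D` with row sums at most `α < 1`, the matrix `1 - D` has a two-sided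
inverse `T` with nonnegative entries. -/
lemma exists_nonneg_resolvent {ι : Type*} [Fintype ι] [DecidableEq ι] {D : ι → ι → ℝ} {α : ℝ}
    (hα : α < 1) (hD : ∀ i j, 0 ≤ D i j) (hrow : ∀ i, ∑ j, D i j ≤ α) :
    ∃ T : ι → ι → ℝ, (∀ i j, 0 ≤ T i j) ∧
      (∀ i j, T i j = (if i = j then 1 else 0) + ∑ k, D i k * T k j) ∧
      ∀ i j, T i j = (if i = j then 1 else 0) + ∑ k, T i k * D k j := by
  -- A vector `v` with `D v ≤ v` is nonnegative: look at its smallest entry.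
  have hpos : ∀ v : ι → ℝ, (∀ i, ∑ k, D i k * v k ≤ v i) → ∀ i, 0 ≤ v i := by
    intro v hv i
    obtain ⟨a, -, ha⟩ := Finset.exists_min_image Finset.univ v ⟨i, Finset.mem_univ i⟩
    refine le_trans ?_ (ha i (Finset.mem_univ i))
    by_contra! hneg
    have h1 : (∑ k, D a k) * v a ≤ v a := by
      refine le_trans ?_ (hv a)
      rw [Finset.sum_mul]
      exact Finset.sum_le_sum fun k _ =>
        mul_le_mul_of_nonneg_left (ha k (Finset.mem_univ k)) (hD a k)
    nlinarith [hrow a]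
  set M : Matrix ι ι ℝ := 1 - Matrix.of D with hM
  have hinj : IsUnit M.det := by
    rw [isUnit_iff_ne_zero]
    intro h0
    obtain ⟨v, hv0, hv⟩ := Matrix.exists_mulVec_eq_zero_iff.2 h0
    have hfix : ∀ i, ∑ k, D i k * v k = v i := by
      intro i
      have := congrFun hv i
      rw [hM, Matrix.sub_mulVec, Matrix.one_mulVec, Pi.sub_apply, Pi.zero_apply] at this
      simp only [Matrix.mulVec, dotProduct, Matrix.of_apply] at this
      linarith
    refine hv0 (funext fun i => le_antisymm ?_ (hpos v (fun i => (hfix i).le) i))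
    have := hpos (-v) (fun i => by simp [hfix i]) i
    simpa using this
  have hR : M * M⁻¹ = 1 := Matrix.mul_nonsing_inv M hinj
  have hL : M⁻¹ * M = 1 := Matrix.nonsing_inv_mul M hinj
  have h1 : ∀ i j, M⁻¹ i j = (if i = j then 1 else 0) + ∑ k, D i k * M⁻¹ k j := by
    intro i j
    have := congrFun (congrFun hR i) j
    rw [hM, sub_mul, one_mul, ← hM, Matrix.sub_apply, Matrix.mul_apply, Matrix.one_apply] at this
    simp only [Matrix.of_apply] at this
    linarith
  have h2 : ∀ i j, M⁻¹ i j = (if i = j then 1 else 0) + ∑ k, M⁻¹ i k * D k j := by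
    intro i j
    have := congrFun (congrFun hL i) j
    rw [hM, mul_sub, mul_one, ← hM, Matrix.sub_apply, Matrix.mul_apply, Matrix.one_apply] at this
    simp only [Matrix.of_apply] at this
    linarith
  refine ⟨fun i j => M⁻¹ i j, fun i j => hpos (fun i => M⁻¹ i j) (fun i => ?_) i, h1, h2⟩
  have := h1 i j
  split_ifs at this <;> linarith

/-- Let `r ≥ 1 + D r` on `S`. Some `j ∈ S` has the property that the total influence of `j` on
the other sites of `S`, accumulated along all paths that do not return to `j`, is at most
`r j - 1`. The reason is that column sums and row sums of `(1 - D)⁻¹` have the same total, and the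
row sums are at most `r`. -/
lemma exists_low_influence {ι : Type*} [Fintype ι] [DecidableEq ι] {D : ι → ι → ℝ} {α : ℝ}
    (hα : α < 1) (hD : ∀ i j, 0 ≤ D i j) (hrow : ∀ i, ∑ j, D i j ≤ α)
    {S : Finset ι} (hS : S.Nonempty) {r : ι → ℝ}
    (hr : ∀ i ∈ S, 1 + ∑ k ∈ S, D i k * r k ≤ r i) :
    ∃ j ∈ S, ∃ u : ι → ℝ, (∀ i, 0 ≤ u i) ∧
      (∀ i ∈ S.erase j, u i = D i j + ∑ k ∈ S.erase j, D i k * u k) ∧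
      1 + ∑ i ∈ S.erase j, u i ≤ r j := by
  set E : ι → ι → ℝ := fun i k => if i ∈ S ∧ k ∈ S then D i k else 0 with hE
  have hE0 : ∀ i j, 0 ≤ E i j := fun i j => by
    simp only [hE]; split_ifs <;> simp [hD]
  obtain ⟨T, hT0, hT1, hT2⟩ := exists_nonneg_resolvent (D := E) hα hE0 fun i =>
    (Finset.sum_le_sum fun j _ => by
      simp only [hE]; split_ifs <;> simp [hD]).trans (hrow i)
  have hEsum : ∀ i ∈ S, ∀ v : ι → ℝ, ∑ k, E i k * v k = ∑ k ∈ S, D i k * v k := by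
    intro i hi v
    rw [← Finset.sum_subset (Finset.subset_univ S)]
    · exact Finset.sum_congr rfl fun k hk => by simp [hE, hi, hk]
    · intro k _ hk
      simp [hE, hk]
  have hEsum' : ∀ k ∈ S, ∀ v : ι → ℝ, ∑ i, v i * E i k = ∑ i ∈ S, v i * D i k := by
    intro k hk v
    rw [← Finset.sum_subset (Finset.subset_univ S)]
    · exact Finset.sum_congr rfl fun i hi => by simp [hE, hi, hk]
    · intro i _ hi
      simp [hE, hi]
  have hrowT : ∀ i ∈ S, ∑ j ∈ S, T i j ≤ r i := by
    intro i hi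
    have key : ∑ k ∈ S, T i k * 1 ≤ ∑ k ∈ S, T i k * (r k - ∑ l ∈ S, D k l * r l) :=
      Finset.sum_le_sum fun k hk =>
        mul_le_mul_of_nonneg_left (by linarith [hr k hk]) (hT0 i k)
    have e : ∑ k ∈ S, T i k * (r k - ∑ l ∈ S, D k l * r l) = r i := by
      simp only [mul_sub, Finset.sum_sub_distrib, Finset.mul_sum]
      rw [Finset.sum_comm (s := S) (t := S), ← Finset.sum_sub_distrib]
      have : ∀ l ∈ S, T i l * r l - ∑ k ∈ S, T i k * (D k l * r l)
          = (if i = l then 1 else 0) * r l := by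
        intro l hl
        rw [hT2 i l, hEsum' l hl]
        simp only [add_mul, Finset.sum_mul, mul_assoc]
        ring
      rw [Finset.sum_congr rfl this]
      simp [hi]
    simpa [e] using key
  obtain ⟨j, hj, hjle⟩ : ∃ j ∈ S, ∑ i ∈ S, T i j ≤ r j := by
    by_contra! hcon
    have h1 : ∑ j ∈ S, r j < ∑ j ∈ S, ∑ i ∈ S, T i j := Finset.sum_lt_sum_of_nonempty hS hcon
    rw [Finset.sum_comm] at h1
    exact absurd (Finset.sum_le_sum hrowT) (not_le.2 h1)
  have hTjj : 1 ≤ T j j := by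
    rw [hT1 j j, if_pos rfl]
    linarith [Finset.sum_nonneg fun k (_ : k ∈ Finset.univ) => mul_nonneg (hE0 j k) (hT0 k j)]
  have hTjj0 : 0 < T j j := by linarith
  refine ⟨j, hj, fun i => T i j / T j j, fun i => div_nonneg (hT0 i j) hTjj0.le, ?_, ?_⟩
  · intro i hi
    obtain ⟨hij, hiS⟩ := Finset.mem_erase.1 hi
    have := hT1 i j
    rw [if_neg hij, hEsum i hiS, ← Finset.add_sum_erase _ _ hj] at this
    simp only [← mul_div_assoc, ← Finset.sum_div]
    rw [div_eq_iff hTjj0.ne', add_mul, div_mul_cancel₀ _ hTjj0.ne']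
    linarith
  · rw [← Finset.add_sum_erase _ _ hj] at hjle
    rw [← Finset.sum_div]
    refine le_trans ?_ hjle
    have hn : 0 ≤ ∑ i ∈ S.erase j, T i j := Finset.sum_nonneg fun i _ => hT0 i j
    have : (∑ i ∈ S.erase j, T i j) / T j j ≤ ∑ i ∈ S.erase j, T i j := div_le_self hn hTjj
    linarith

/-! ### Resampling one coordinate -/

/-- The integrals of a function of oscillation at most `δ` under two probability measures at total
variation distance at most `d` differ by at most `d * δ`. -/
lemma abs_integral_sub_integral_le {Z : Type*} [MeasurableSpace Z] {P Q : Measure Z}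
    [IsProbabilityMeasure P] [IsProbabilityMeasure Q] {d δ : ℝ} {h : Z → ℝ} (hh : Measurable h)
    (hδ : ∀ z z', |h z - h z'| ≤ δ)
    (hd : ∀ A, MeasurableSet A → |P.real A - Q.real A| ≤ d) :
    |(∫ z, h z ∂P) - ∫ z, h z ∂Q| ≤ d * δ := by
  obtain ⟨z₀⟩ : Nonempty Z := nonempty_of_isProbabilityMeasure P
  have hδ0 : 0 ≤ δ := (abs_nonneg _).trans (hδ z₀ z₀)
  have hbdd : BddBelow (Set.range h) := by
    refine ⟨h z₀ - δ, ?_⟩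
    rintro _ ⟨z, rfl⟩
    linarith [(abs_le.1 (hδ z₀ z)).2]
  set a := ⨅ z, h z with ha
  have hlo : ∀ z, 0 ≤ h z - a := fun z => sub_nonneg.2 (ciInf_le hbdd z)
  have : Nonempty Z := ⟨z₀⟩
  have hhi : ∀ z, h z - a ≤ δ := by
    intro z
    have : h z - δ ≤ a := le_ciInf fun z' => by linarith [(abs_le.1 (hδ z z')).2]
    linarith
  have hint : ∀ ρ : Measure Z, IsProbabilityMeasure ρ → Integrable (fun z => h z - a) ρ :=
    fun ρ _ => Integrable.of_bound (hh.sub_const a).aestronglyMeasurable δ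
      (Filter.Eventually.of_forall fun z => by
        rw [Real.norm_eq_abs, abs_of_nonneg (hlo z)]; exact hhi z)
  have hlayer : ∀ ρ : Measure Z, IsProbabilityMeasure ρ →
      (∫ z, h z ∂ρ) - a = ∫ t in Set.Ioc 0 δ, ρ.real {z | t ≤ h z - a} := by
    intro ρ hρ
    rw [← (hint ρ hρ).integral_eq_integral_Ioc_meas_le (Filter.Eventually.of_forall hlo)
      (Filter.Eventually.of_forall hhi)]
    have hi : Integrable h ρ := by
      simpa [Pi.add_def] using (hint ρ hρ).add (integrable_const a)
    rw [integral_sub hi (integrable_const a)]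
    simp
  have hlint : ∀ ρ : Measure Z, IsProbabilityMeasure ρ →
      IntegrableOn (fun t => ρ.real {z | t ≤ h z - a}) (Set.Ioc 0 δ) := by
    intro ρ hρ
    refine Integrable.of_bound ?_ 1 (Filter.Eventually.of_forall fun t => ?_)
    · refine (Antitone.measurable fun s t hst => ?_).aestronglyMeasurable
      exact measureReal_mono fun z (hz : t ≤ h z - a) => hst.trans hz
    · rw [Real.norm_eq_abs, abs_of_nonneg measureReal_nonneg]
      exact measureReal_le_one
  have e : (∫ z, h z ∂P) - ∫ z, h z ∂Q =
      ∫ t in Set.Ioc 0 δ, (P.real {z | t ≤ h z - a} - Q.real {z | t ≤ h z - a}) := by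
    rw [integral_sub (hlint P inferInstance) (hlint Q inferInstance), ← hlayer P inferInstance,
      ← hlayer Q inferInstance]
    ring
  rw [e, ← Real.norm_eq_abs]
  refine (norm_setIntegral_le_of_norm_le_const (C := d) measure_Ioc_lt_top fun t _ => ?_).trans ?_
  · exact hd _ (measurableSet_le measurable_const (hh.sub_const a))
  · simp [hδ0]

/-- A system of single-site conditional laws for `P`, with influence matrix `D`: the kernel `K i`
ignores coordinate `i` of its argument, changing coordinate `j` of the argument moves it by at most
`D i j` in total variation, and drawing coordinate `i` afresh from `K i` preserves `P`. -/
structure IsGibbsSystem {ι Z : Type*} [DecidableEq ι] [MeasurableSpace Z]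
    (P : Measure (ι → Z)) (K : ι → Kernel (ι → Z) Z) (D : ι → ι → ℝ) : Prop where
  markov : ∀ i, IsMarkovKernel (K i)
  update_self : ∀ i x z, K i (Function.update x i z) = K i x
  influence_le : ∀ i j x z A, MeasurableSet A →
    |(K i (Function.update x j z)).real A - (K i x).real A| ≤ D i j
  invariant : ∀ i (g : (ι → Z) → ℝ), Measurable g → (∃ C, ∀ x, |g x| ≤ C) →
    ∫ x, ∫ z, g (Function.update x i z) ∂K i x ∂P = ∫ x, g x ∂P

/-- `c i` bounds the change of `f` when only coordinate `i` is modified. -/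
def OscBound {ι Z : Type*} [DecidableEq ι] (f : (ι → Z) → ℝ) (c : ι → ℝ) : Prop :=
  ∀ i x z, |f (Function.update x i z) - f x| ≤ c i

/-- `f` does not depend on the coordinates in `S`, expressed by one-coordinate modifications. -/
def IndepOf {ι Z : Type*} [DecidableEq ι] (f : (ι → Z) → ℝ) (S : Finset ι) : Prop :=
  ∀ i ∈ S, ∀ x z, f (Function.update x i z) = f x

/-- Bounded measurable real functions. -/
def BddMeas {Ω : Type*} [MeasurableSpace Ω] (f : Ω → ℝ) : Prop :=
  Measurable f ∧ ∃ C, ∀ x, |f x| ≤ C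

lemma BddMeas.integrable {Ω : Type*} [MeasurableSpace Ω] {P : Measure Ω} [IsFiniteMeasure P]
    {f : Ω → ℝ} (hf : BddMeas f) : Integrable f P := by
  obtain ⟨hm, C, hC⟩ := hf
  exact Integrable.of_bound hm.aestronglyMeasurable C (Filter.Eventually.of_forall hC)

lemma BddMeas.mul {Ω : Type*} [MeasurableSpace Ω] {f g : Ω → ℝ}
    (hf : BddMeas f) (hg : BddMeas g) : BddMeas fun x => f x * g x := by
  obtain ⟨hm, C, hC⟩ := hf
  obtain ⟨hm', C', hC'⟩ := hg
  refine ⟨hm.mul hm', C * C', fun x => ?_⟩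
  rw [abs_mul]
  exact mul_le_mul (hC x) (hC' x) (abs_nonneg _) ((abs_nonneg _).trans (hC x))

lemma BddMeas.sub {Ω : Type*} [MeasurableSpace Ω] {f g : Ω → ℝ}
    (hf : BddMeas f) (hg : BddMeas g) : BddMeas fun x => f x - g x := by
  obtain ⟨hm, C, hC⟩ := hf
  obtain ⟨hm', C', hC'⟩ := hg
  exact ⟨hm.sub hm', C + C', fun x => (abs_sub _ _).trans (add_le_add (hC x) (hC' x))⟩

lemma BddMeas.exp {Ω : Type*} [MeasurableSpace Ω] {f : Ω → ℝ}
    (hf : BddMeas f) : BddMeas fun x => Real.exp (f x) := by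
  obtain ⟨hm, C, hC⟩ := hf
  refine ⟨hm.exp, Real.exp C, fun x => ?_⟩
  rw [abs_of_pos (Real.exp_pos _)]
  exact Real.exp_le_exp.2 ((le_abs_self _).trans (hC x))

lemma BddMeas.const {Ω : Type*} [MeasurableSpace Ω] (a : ℝ) : BddMeas fun _ : Ω => a :=
  ⟨measurable_const, |a|, fun _ => le_rfl⟩

lemma BddMeas.comp {Ω Ω' : Type*} [MeasurableSpace Ω] [MeasurableSpace Ω'] {f : Ω → ℝ}
    (hf : BddMeas f) {φ : Ω' → Ω} (hφ : Measurable φ) : BddMeas fun x => f (φ x) :=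
  ⟨hf.1.comp hφ, hf.2.imp fun _ h x => h (φ x)⟩

/-- The conditional expectation of `g` when coordinate `i` is drawn afresh from `K i`. -/
noncomputable def resample {ι Z : Type*} [DecidableEq ι] [MeasurableSpace Z]
    (K : ι → Kernel (ι → Z) Z) (i : ι) (g : (ι → Z) → ℝ) (x : ι → Z) : ℝ :=
  ∫ z, g (Function.update x i z) ∂K i x

section Resample

variable {ι Z : Type*} [DecidableEq ι] [MeasurableSpace Z]
  {P : Measure (ι → Z)} {K : ι → Kernel (ι → Z) Z} {D : ι → ι → ℝ} {g : (ι → Z) → ℝ}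

lemma IsGibbsSystem.influence_nonneg [Nonempty Z] (h : IsGibbsSystem P K D) (i j : ι) :
    0 ≤ D i j := by
  obtain ⟨z⟩ := ‹Nonempty Z›
  exact (abs_nonneg _).trans (h.influence_le i j (fun _ => z) z ∅ MeasurableSet.empty)

lemma measurable_comp_update (hg : Measurable g) (i : ι) (x : ι → Z) :
    Measurable fun z => g (Function.update x i z) :=
  hg.comp (measurable_update x)

lemma IsGibbsSystem.measurable_resample (h : IsGibbsSystem P K D) (hg : Measurable g) (i : ι) :
    Measurable (resample K i g) := by
  have := h.markov i
  have hm : StronglyMeasurable fun p : (ι → Z) × Z => g (Function.update p.1 i p.2) :=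
    (hg.comp measurable_update').stronglyMeasurable
  exact (hm.integral_kernel_prod_right' (κ := K i)).measurable

lemma IsGibbsSystem.abs_resample_le (h : IsGibbsSystem P K D) {C : ℝ} (hC : ∀ x, |g x| ≤ C)
    (i : ι) (x : ι → Z) : |resample K i g x| ≤ C := by
  have := h.markov i
  have := norm_integral_le_of_norm_le_const (μ := K i x)
    (f := fun z => g (Function.update x i z)) (C := C) (Filter.Eventually.of_forall fun z => hC _)
  simpa [resample] using this

lemma IsGibbsSystem.resample_update (h : IsGibbsSystem P K D) (i : ι) (x : ι → Z) (z : Z) :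
    resample K i g (Function.update x i z) = resample K i g x := by
  simp [resample, h.update_self]

lemma IsGibbsSystem.abs_resample_sub_le (h : IsGibbsSystem P K D) (hg : BddMeas g) {c : ι → ℝ}
    (hc : OscBound g c) (i : ι) (x : ι → Z) : |resample K i g x - g x| ≤ c i := by
  have := h.markov i
  have hi : Integrable (fun z => g (Function.update x i z)) (K i x) :=
    (hg.comp (measurable_update x)).integrable
  have e : resample K i g x - g x = ∫ z, (g (Function.update x i z) - g x) ∂K i x := by
    rw [integral_sub hi (integrable_const _)]
    simp [resample]
  have := norm_integral_le_of_norm_le_const (μ := K i x)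
    (f := fun z => g (Function.update x i z) - g x) (C := c i)
    (Filter.Eventually.of_forall fun z => hc i x z)
  rw [e]
  simpa using this

/-- Resampling coordinate `i` removes the oscillation there and passes a fraction `D i k` of it on
to coordinate `k`. -/
lemma IsGibbsSystem.oscBound_resample (h : IsGibbsSystem P K D) (hg : BddMeas g) {c : ι → ℝ}
    (hc : OscBound g c) (i : ι) :
    OscBound (resample K i g) fun k => if k = i then 0 else c k + D i k * c i := by
  intro k x z
  dsimp only
  split_ifs with hk
  · subst hk
    simp [h.resample_update]
  have := h.markov i
  set x' := Function.update x k z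
  have hi : ∀ y y' : ι → Z, Integrable (fun w => g (Function.update y i w)) (K i y') := fun y y' =>
    (hg.comp (measurable_update y)).integrable
  have h1 : |∫ w, (g (Function.update x' i w) - g (Function.update x i w)) ∂K i x'| ≤ c k := by
    have := norm_integral_le_of_norm_le_const (μ := K i x')
      (f := fun w => g (Function.update x' i w) - g (Function.update x i w)) (C := c k)
      (Filter.Eventually.of_forall fun w => by
        simp only [x']
        rw [Function.update_comm hk, Real.norm_eq_abs]
        exact hc k _ _)
    simpa using this
  have h2 : |(∫ w, g (Function.update x i w) ∂K i x') - ∫ w, g (Function.update x i w) ∂K i x|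
      ≤ D i k * c i := by
    refine abs_integral_sub_integral_le (measurable_comp_update hg.1 i x) (fun w w' => ?_)
      (h.influence_le i k x z)
    have := hc i (Function.update x i w') w
    rwa [Function.update_idem] at this
  rw [integral_sub (hi _ _) (hi _ _)] at h1
  have e : resample K i g x' - resample K i g x
      = ((∫ w, g (Function.update x' i w) ∂K i x') - ∫ w, g (Function.update x i w) ∂K i x')
        + ((∫ w, g (Function.update x i w) ∂K i x') - ∫ w, g (Function.update x i w) ∂K i x) := by
    simp only [resample]
    ring
  rw [e]
  exact (abs_add_le _ _).trans (add_le_add h1 h2)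

lemma IsGibbsSystem.integral_mul_resample (h : IsGibbsSystem P K D) (hg : BddMeas g)
    {i : ι} {ξ : (ι → Z) → ℝ} (hξ : BddMeas ξ) (hξi : ∀ x z, ξ (Function.update x i z) = ξ x) :
    ∫ x, ξ x * resample K i g x ∂P = ∫ x, ξ x * g x ∂P := by
  rw [← h.invariant i (fun x => ξ x * g x) (hξ.mul hg).1 (hξ.mul hg).2]
  refine integral_congr_ae (Filter.Eventually.of_forall fun x => ?_)
  simp only [resample, hξi]
  rw [integral_const_mul]

end Resample

/-! ### Conditional expectations by repeated resampling -/

lemma OscBound.nonneg {ι Z : Type*} [DecidableEq ι] [Nonempty Z] {f : (ι → Z) → ℝ} {c : ι → ℝ} (hc : OscBound f c) (i : ι) :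
    0 ≤ c i := by
  obtain ⟨z⟩ := ‹Nonempty Z›
  exact (abs_nonneg _).trans (hc i (fun _ => z) z)

/-- When a coordinate `i ∈ S` is resampled, the total oscillation over `S` with weights `u` drops
by at least `c i` times the slack of the inequality `D u ≤ u` at `i`. -/
lemma sum_mul_resample_osc_le {ι : Type*} [DecidableEq ι] {D : ι → ι → ℝ} {S : Finset ι} {i : ι} (hi : i ∈ S) {u c : ι → ℝ}
    (hu : ∀ k, 0 ≤ u k) (hc : ∀ k, 0 ≤ c k) (hD : ∀ k, 0 ≤ D i k) :
    ∑ k ∈ S, u k * (if k = i then 0 else c k + D i k * c i)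
      ≤ ∑ k ∈ S, u k * c k - c i * (u i - ∑ k ∈ S, D i k * u k) := by
  rw [← Finset.add_sum_erase _ _ hi, ← Finset.add_sum_erase _ _ hi,
    ← Finset.add_sum_erase S (fun k => D i k * u k) hi]
  have e : ∑ k ∈ S.erase i, u k * (if k = i then 0 else c k + D i k * c i)
      = ∑ k ∈ S.erase i, u k * c k + c i * ∑ k ∈ S.erase i, D i k * u k := by
    rw [Finset.mul_sum, ← Finset.sum_add_distrib]
    refine Finset.sum_congr rfl fun k hk => ?_
    rw [if_neg (Finset.ne_of_mem_erase hk)]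
    ring
  rw [e, if_pos rfl]
  nlinarith [mul_nonneg (hc i) (mul_nonneg (hD i) (hu i))]

section CondAverage

variable {ι Z : Type*} [Fintype ι] [DecidableEq ι] [MeasurableSpace Z]
  {P : Measure (ι → Z)} {K : ι → Kernel (ι → Z) Z} {D : ι → ι → ℝ}

/-- An everywhere defined version `F` of the conditional expectation of `f` given the coordinates
outside `S`, obtained as a uniform limit of resamplings. It keeps control of the oscillation in
a coordinate `j ∉ S`; no regularity of the space `Z` is needed. -/
lemma IsGibbsSystem.exists_condAverage [IsProbabilityMeasure P] [Nonempty Z]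
    (h : IsGibbsSystem P K D) {α : ℝ} (hα : α < 1) (hrow : ∀ i, ∑ j, D i j ≤ α)
    {S : Finset ι} {j : ι} (hj : j ∉ S) {u : ι → ℝ} (hu0 : ∀ i, 0 ≤ u i)
    (hu : ∀ i ∈ S, D i j + ∑ k ∈ S, D i k * u k ≤ u i)
    {f : (ι → Z) → ℝ} (hf : BddMeas f) {c : ι → ℝ} (hc : OscBound f c) :
    ∃ F : (ι → Z) → ℝ, BddMeas F ∧ IndepOf F S ∧
      (∀ ξ : (ι → Z) → ℝ, BddMeas ξ → IndepOf ξ S → ∫ x, ξ x * F x ∂P = ∫ x, ξ x * f x ∂P) ∧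
      ∀ x z, |F (Function.update x j z) - F x| ≤ c j + ∑ i ∈ S, u i * c i := by
  have hD : ∀ i k, 0 ≤ D i k := h.influence_nonneg
  rcases S.eq_empty_or_nonempty with rfl | hS
  · exact ⟨f, hf, by simp [IndepOf], fun _ _ _ => rfl, fun x z => by simpa using hc j x z⟩
  obtain ⟨hfm, C, hC⟩ := hf
  have hα0 : 0 ≤ α := (Finset.sum_nonneg fun k _ => hD j k).trans (hrow j)
  have hcard : (1 : ℝ) ≤ S.card := by exact_mod_cast hS.card_pos
  set ρ : ℝ := 1 - (1 - α) / S.card with hρ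
  have hρ1 : ρ < 1 := by
    have : 0 < (1 - α) / S.card := div_pos (by linarith) (by linarith)
    linarith
  have hρ0 : 0 ≤ ρ := by
    have : (1 - α) / S.card ≤ 1 := by
      rw [div_le_one (by linarith)]; linarith
    linarith
  let Ψ : (ι → ℝ) → ℝ := fun d => ∑ i ∈ S, d i
  let Inv : ((ι → Z) → ℝ) × (ι → ℝ) → Prop := fun p =>
    Measurable p.1 ∧ (∀ x, |p.1 x| ≤ C) ∧ OscBound p.1 p.2 ∧
    (∀ ξ : (ι → Z) → ℝ, BddMeas ξ → IndepOf ξ S → ∫ x, ξ x * p.1 x ∂P = ∫ x, ξ x * f x ∂P) ∧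
    p.2 j + ∑ i ∈ S, u i * p.2 i ≤ c j + ∑ i ∈ S, u i * c i
  -- Resampling the coordinate of largest oscillation shrinks the total oscillation over `S`.
  have hstep : ∀ p : {p // Inv p}, ∃ q : {p // Inv p},
      Ψ q.1.2 ≤ ρ * Ψ p.1.2 ∧ ∀ x, |q.1.1 x - p.1.1 x| ≤ Ψ p.1.2 := by
    rintro ⟨⟨g, d⟩, hgm, hgC, hd, hgξ, hgu⟩
    dsimp only at hgm hgC hd hgξ hgu ⊢
    have hd0 := hd.nonneg
    obtain ⟨i, hi, himax⟩ := Finset.exists_max_image S d hS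
    have hg : BddMeas g := ⟨hgm, C, hgC⟩
    refine ⟨⟨⟨resample K i g, fun k => if k = i then 0 else d k + D i k * d i⟩,
      h.measurable_resample hgm i, h.abs_resample_le hgC i, h.oscBound_resample hg hd i,
      fun ξ hξ hξS => ?_, ?_⟩, ?_, fun x => ?_⟩
    · rw [← hgξ ξ hξ hξS, h.integral_mul_resample hg hξ (hξS i hi)]
    · have h1 := sum_mul_resample_osc_le hi hu0 hd0 (hD i)
      have hji : j ≠ i := fun e => hj (e ▸ hi)
      have h2 := mul_le_mul_of_nonneg_left (hu i hi) (hd0 i)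
      simp only [if_neg hji]
      nlinarith
    · have h1 := sum_mul_resample_osc_le (u := fun _ => 1) hi (fun _ => zero_le_one) hd0 (hD i)
      simp only [one_mul, mul_one] at h1
      have h2 : ∑ k ∈ S, D i k ≤ α := (Finset.sum_le_sum_of_subset_of_nonneg
        (Finset.subset_univ S) fun k _ _ => hD i k).trans (hrow i)
      have h3 : ∑ k ∈ S, d k ≤ S.card * d i := by
        simpa using Finset.sum_le_card_nsmul S d (d i) himax
      have h4 : (1 - α) / S.card * ∑ k ∈ S, d k ≤ (1 - α) * d i := by
        rw [div_mul_eq_mul_div, div_le_iff₀ (by linarith)]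
        nlinarith
      have h5 := mul_le_mul_of_nonneg_left h2 (hd0 i)
      simp only [Ψ, hρ]
      nlinarith
    · exact (h.abs_resample_sub_le hg hd i x).trans
        (Finset.single_le_sum (fun k _ => hd0 k) hi)
  choose step hstepΨ hstepd using hstep
  let s₀ : {p // Inv p} := ⟨⟨f, c⟩, hfm, hC, hc, fun _ _ _ => rfl, le_rfl⟩
  let s : ℕ → {p // Inv p} := fun n => step^[n] s₀
  have hs : ∀ n, s (n + 1) = step (s n) := fun n => Function.iterate_succ_apply' step n s₀
  have hΨ : ∀ n, Ψ (s n).1.2 ≤ Ψ c * ρ ^ n := by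
    intro n
    induction n with
    | zero => simp [s, s₀]
    | succ n ih =>
      rw [hs, pow_succ]
      nlinarith [hstepΨ (s n), mul_le_mul_of_nonneg_left ih hρ0]
  have hcauchy : ∀ x, CauchySeq fun n => (s n).1.1 x := fun x =>
    cauchySeq_of_le_geometric ρ (Ψ c) hρ1 fun n => by
      rw [dist_comm, Real.dist_eq, hs]
      exact (hstepd (s n) x).trans (hΨ n)
  choose F hF using fun x => cauchySeq_tendsto_of_complete (hcauchy x)
  have hFm : Measurable F :=
    measurable_of_tendsto_metrizable (fun n => (s n).2.1) (tendsto_pi_nhds.2 hF)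
  have hFC : ∀ x, |F x| ≤ C := fun x =>
    le_of_tendsto (hF x).abs (Filter.Eventually.of_forall fun n => (s n).2.2.1 x)
  have hosc0 : ∀ n i, 0 ≤ (s n).1.2 i := fun n => (s n).2.2.2.1.nonneg
  have hΨ0 : Filter.Tendsto (fun n => Ψ c * ρ ^ n) Filter.atTop (nhds 0) := by
    simpa using (tendsto_pow_atTop_nhds_zero_of_lt_one hρ0 hρ1).const_mul (Ψ c)
  refine ⟨F, ⟨hFm, C, hFC⟩, fun i hi x z => ?_, fun ξ hξ hξS => ?_, fun x z => ?_⟩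
  · have h1 : |F (Function.update x i z) - F x| ≤ 0 := by
      refine le_of_tendsto_of_tendsto (((hF _).sub (hF x)).abs) hΨ0
        (Filter.Eventually.of_forall fun n => ?_)
      exact ((s n).2.2.2.1 i x z).trans
        ((Finset.single_le_sum (fun k _ => hosc0 n k) hi).trans (hΨ n))
    exact sub_eq_zero.1 (abs_nonpos_iff.1 h1)
  · obtain ⟨hξm, C', hC'⟩ := hξ
    have hlim : Filter.Tendsto (fun n => ∫ x, ξ x * (s n).1.1 x ∂P) Filter.atTop
        (nhds (∫ x, ξ x * F x ∂P)) := by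
      refine tendsto_integral_of_dominated_convergence (fun _ => C' * C)
        (fun n => (hξm.mul (s n).2.1).aestronglyMeasurable) (integrable_const _)
        (fun n => Filter.Eventually.of_forall fun x => ?_)
        (Filter.Eventually.of_forall fun x => (hF x).const_mul (ξ x))
      rw [Real.norm_eq_abs, abs_mul]
      exact mul_le_mul (hC' x) ((s n).2.2.1 x) (abs_nonneg _) ((abs_nonneg _).trans (hC' x))
    refine tendsto_nhds_unique hlim ?_
    simp_rw [fun n => (s n).2.2.2.2.1 ξ ⟨hξm, C', hC'⟩ hξS]
    exact tendsto_const_nhds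
  · refine le_of_tendsto (((hF _).sub (hF x)).abs) (Filter.Eventually.of_forall fun n => ?_)
    refine ((s n).2.2.2.1 j x z).trans (le_trans ?_ (s n).2.2.2.2.2)
    exact le_add_of_nonneg_right (Finset.sum_nonneg fun i _ => mul_nonneg (hu0 i) (hosc0 n i))

end CondAverage

/-! ### The moment generating function -/

section Mgf

variable {ι Z : Type*} [Fintype ι] [DecidableEq ι] [MeasurableSpace Z]
  {P : Measure (ι → Z)} {K : ι → Kernel (ι → Z) Z} {D : ι → ι → ℝ}

/-- The coordinates in `S` are integrated out one at a time. The budget `r` starts with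
`r ≥ 1 + D r` on `S`; removing the coordinate `j` with path influences `u` leaves the
budget `r - r j • u` for the others, which satisfies the same inequality on `S \ {j}`. The freed
amount pays for the oscillation `c j + ∑ u i c i` of the conditional expectation in coordinate `j`
by the Cauchy–Schwarz inequality. -/
lemma IsGibbsSystem.integral_mul_exp_le [IsProbabilityMeasure P] [Nonempty Z]
    (h : IsGibbsSystem P K D) {α : ℝ} (hα : α < 1) (hrow : ∀ i, ∑ j, D i j ≤ α)
    {f : (ι → Z) → ℝ} (hf : BddMeas f) {c : ι → ℝ} (hc : OscBound f c) (S : Finset ι) :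
    ∀ r : ι → ℝ, (∀ i ∈ S, 1 + ∑ k ∈ S, D i k * r k ≤ r i) →
    ∀ F : (ι → Z) → ℝ, BddMeas F → IndepOf F S →
    (∀ ξ : (ι → Z) → ℝ, BddMeas ξ → IndepOf ξ S → ∫ x, ξ x * F x ∂P = ∫ x, ξ x * f x ∂P) →
    ∀ ξ : (ι → Z) → ℝ, BddMeas ξ → IndepOf ξ S → (∀ x, 0 ≤ ξ x) →
    ∫ x, ξ x * Real.exp (f x) ∂P
      ≤ (∫ x, ξ x * Real.exp (F x) ∂P) * Real.exp ((∑ i ∈ S, r i * c i ^ 2) / 2) := by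
  have hD : ∀ i k, 0 ≤ D i k := h.influence_nonneg
  induction S using Finset.strongInduction with
  | H S ih =>
  intro r hr F hF hFS hFf ξ hξ hξS hξ0
  rcases S.eq_empty_or_nonempty with rfl | hS
  · have h0 : ∫ x, (F x - f x) * (F x - f x) ∂P = 0 := by
      have h1 := hFf (fun x => F x - f x) (hF.sub hf) (by simp [IndepOf])
      have h2 : ∀ x, (F x - f x) * (F x - f x) = (F x - f x) * F x - (F x - f x) * f x :=
        fun x => by ring
      simp_rw [h2]
      rw [integral_sub ((hF.sub hf).mul hF).integrable ((hF.sub hf).mul hf).integrable, h1, sub_self]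
    rw [integral_eq_zero_iff_of_nonneg (fun x => mul_self_nonneg _)
      ((hF.sub hf).mul (hF.sub hf)).integrable] at h0
    simp only [Finset.sum_empty, zero_div, Real.exp_zero, mul_one]
    refine le_of_eq (integral_congr_ae ?_)
    filter_upwards [h0] with x hx
    have : F x - f x = 0 := mul_self_eq_zero.1 hx
    rw [show f x = F x by linarith]
  obtain ⟨j, hj, u, hu0, hu, huj⟩ := exists_low_influence hα hD hrow hS hr
  have hjS : j ∉ S.erase j := Finset.notMem_erase j S
  obtain ⟨F', hF', hF'S, hF'f, hF'osc⟩ := h.exists_condAverage hα hrow hjS hu0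
    (fun i hi => (hu i hi).ge) hf hc
  have hc0 := hc.nonneg
  have hsub : ∀ g : (ι → Z) → ℝ, IndepOf g S → IndepOf g (S.erase j) :=
    fun g hg i hi => hg i (Finset.mem_of_mem_erase hi)
  set w : ℝ := c j + ∑ i ∈ S.erase j, u i * c i with hw
  have hw0 : 0 ≤ w := add_nonneg (hc0 j) (Finset.sum_nonneg fun i _ => mul_nonneg (hu0 i) (hc0 i))
  -- The budget left for the remaining coordinates.
  have hIH := ih (S.erase j) (Finset.erase_ssubset hj) (fun i => r i - r j * u i)
    (fun i hi => by
      have h1 := hr i (Finset.mem_of_mem_erase hi)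
      rw [← Finset.add_sum_erase _ _ hj] at h1
      have h2 := hu i hi
      simp only [mul_sub, Finset.sum_sub_distrib]
      have h3 : ∑ k ∈ S.erase j, D i k * (r j * u k) = r j * ∑ k ∈ S.erase j, D i k * u k := by
        rw [Finset.mul_sum]
        exact Finset.sum_congr rfl fun k _ => by ring
      rw [h3]
      have h4 : r j * u i = r j * D i j + r j * ∑ k ∈ S.erase j, D i k * u k := by
        conv_lhs => rw [h2]
        ring
      linarith)
    F' hF' hF'S hF'f ξ hξ (hsub ξ hξS) hξ0
  have hbudget : w ^ 2 + ∑ i ∈ S.erase j, (r i - r j * u i) * c i ^ 2 ≤ ∑ i ∈ S, r i * c i ^ 2 := by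
    have hcs : (∑ i ∈ S.erase j, u i * c i) ^ 2
        ≤ (∑ i ∈ S.erase j, u i) * ∑ i ∈ S.erase j, u i * c i ^ 2 :=
      Finset.sum_sq_le_sum_mul_sum_of_sq_le_mul _ (fun i _ => hu0 i)
        (fun i _ => mul_nonneg (hu0 i) (sq_nonneg _)) fun i _ => le_of_eq (by ring)
    have hQ : 0 ≤ ∑ i ∈ S.erase j, u i * c i ^ 2 :=
      Finset.sum_nonneg fun i _ => mul_nonneg (hu0 i) (sq_nonneg _)
    have hU : 0 ≤ ∑ i ∈ S.erase j, u i := Finset.sum_nonneg fun i _ => hu0 i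
    have hV : 0 ≤ ∑ i ∈ S.erase j, u i * c i :=
      Finset.sum_nonneg fun i _ => mul_nonneg (hu0 i) (hc0 i)
    rw [← Finset.add_sum_erase _ _ hj]
    simp only [sub_mul, Finset.sum_sub_distrib]
    have h3 : ∑ i ∈ S.erase j, r j * u i * c i ^ 2 = r j * ∑ i ∈ S.erase j, u i * c i ^ 2 := by
      rw [Finset.mul_sum]
      exact Finset.sum_congr rfl fun k _ => by ring
    rw [h3, hw]
    set U := ∑ i ∈ S.erase j, u i
    set V := ∑ i ∈ S.erase j, u i * c i
    set Q := ∑ i ∈ S.erase j, u i * c i ^ 2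
    have h4 : (c j + V) ^ 2 ≤ (1 + U) * (c j ^ 2 + Q) := by
      have h5 : 2 * (c j * V) ≤ U * c j ^ 2 + Q := by
        rcases hU.eq_or_lt with hU0 | hU0
        · have : V = 0 := by
            have : V ^ 2 ≤ 0 := by rw [← hU0] at hcs; simpa using hcs
            nlinarith
          rw [this, ← hU0]
          linarith
        · have h6 : 0 ≤ (U * c j - V) ^ 2 := sq_nonneg _
          have h7 : U * (2 * (c j * V)) ≤ U * (U * c j ^ 2 + Q) := by nlinarith
          exact le_of_mul_le_mul_left h7 hU0
      nlinarith
    have h8 : (1 + U) * (c j ^ 2 + Q) ≤ r j * (c j ^ 2 + Q) :=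
      mul_le_mul_of_nonneg_right huj (add_nonneg (sq_nonneg _) hQ)
    linarith
  obtain ⟨z₀⟩ := ‹Nonempty Z›
  -- Freezing coordinate `j` gives a function of the coordinates outside `S` within `w` of `F'`.
  set N : (ι → Z) → ℝ := fun x => F' (Function.update x j z₀) with hN
  have hNb : BddMeas N := hF'.comp measurable_update_left
  have hNS : IndepOf N S := by
    intro i hi x z
    simp only [hN]
    by_cases hij : i = j
    · subst hij
      rw [Function.update_idem]
    · rw [Function.update_comm hij]
      exact hF'S i (Finset.mem_erase.2 ⟨hij, hi⟩) _ _
  have hNw : ∀ x, |F' x - N x| ≤ w := fun x => by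
    rw [abs_sub_comm]
    exact hF'osc x z₀
  obtain ⟨s, hs1, hs2⟩ := exists_chord_bound hw0
  set η : (ι → Z) → ℝ := fun x => ξ x * Real.exp (N x) with hη
  have hηb : BddMeas η := hξ.mul hNb.exp
  have hηS : IndepOf η S := fun i hi x z => by simp only [hη, hξS i hi x z, hNS i hi x z]
  have hη0 : ∀ x, 0 ≤ η x := fun x => mul_nonneg (hξ0 x) (Real.exp_pos _).le
  have hηF : ∫ x, η x * F' x ∂P = ∫ x, η x * F x ∂P := by
    rw [hF'f η hηb (hsub η hηS), hFf η hηb hηS]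
  have hlin : ∀ G : (ι → Z) → ℝ, BddMeas G → ∫ x, η x * (Real.cosh w + s * (G x - N x)) ∂P
      = (∫ x, η x * Real.cosh w ∂P) + s * ((∫ x, η x * G x ∂P) - ∫ x, η x * N x ∂P) := by
    intro G hG
    rw [← integral_sub (hηb.mul hG).integrable (hηb.mul hNb).integrable, ← integral_const_mul,
      ← integral_add (hηb.mul (BddMeas.const _)).integrable
        (((hηb.mul hG).sub (hηb.mul hNb)).integrable.const_mul s)]
    exact integral_congr_ae (Filter.Eventually.of_forall fun x => by simp only; ring)
  have hchordb : ∀ G : (ι → Z) → ℝ, BddMeas G →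
      Integrable (fun x => η x * (Real.cosh w + s * (G x - N x))) P := by
    intro G hG
    have := ((hηb.mul (BddMeas.const (Real.cosh w))).integrable (P := P)).add
      ((hηb.mul (hG.sub hNb)).integrable.const_mul s)
    refine this.congr (Filter.Eventually.of_forall fun x => ?_)
    simp only [Pi.add_apply]
    ring
  have hmain : ∫ x, ξ x * Real.exp (F' x) ∂P
      ≤ (∫ x, ξ x * Real.exp (F x) ∂P) * Real.exp (w ^ 2 / 2) := by
    calc ∫ x, ξ x * Real.exp (F' x) ∂P
        ≤ ∫ x, η x * (Real.cosh w + s * (F' x - N x)) ∂P := by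
          refine integral_mono (hξ.mul hF'.exp).integrable (hchordb F' hF') fun x => ?_
          have := mul_le_mul_of_nonneg_left (hs1 _ (hNw x)) (hη0 x)
          refine le_trans (le_of_eq ?_) this
          simp only [hη]
          rw [mul_assoc, ← Real.exp_add]
          ring_nf
      _ = ∫ x, η x * (Real.cosh w + s * (F x - N x)) ∂P := by
          rw [hlin F' hF', hlin F hF, hηF]
      _ ≤ ∫ x, (ξ x * Real.exp (F x)) * Real.exp (w ^ 2 / 2) ∂P := by
          refine integral_mono (hchordb F hF) ((hξ.mul hF.exp).integrable.mul_const _) fun x => ?_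
          have := mul_le_mul_of_nonneg_left (hs2 (F x - N x)) (hη0 x)
          refine this.trans (le_of_eq ?_)
          simp only [hη]
          rw [mul_assoc, mul_assoc, ← Real.exp_add, ← Real.exp_add]
          ring_nf
      _ = _ := integral_mul_const _ _
  have hJ0 : 0 ≤ ∫ x, ξ x * Real.exp (F x) ∂P :=
    integral_nonneg fun x => mul_nonneg (hξ0 x) (Real.exp_pos _).le
  calc ∫ x, ξ x * Real.exp (f x) ∂P
      ≤ (∫ x, ξ x * Real.exp (F' x) ∂P)
          * Real.exp ((∑ i ∈ S.erase j, (r i - r j * u i) * c i ^ 2) / 2) := hIH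
    _ ≤ ((∫ x, ξ x * Real.exp (F x) ∂P) * Real.exp (w ^ 2 / 2))
          * Real.exp ((∑ i ∈ S.erase j, (r i - r j * u i) * c i ^ 2) / 2) := by gcongr
    _ = (∫ x, ξ x * Real.exp (F x) ∂P)
          * Real.exp ((w ^ 2 + ∑ i ∈ S.erase j, (r i - r j * u i) * c i ^ 2) / 2) := by
        rw [mul_assoc, ← Real.exp_add, add_div]
    _ ≤ _ := by gcongr

/-- McDiarmid's inequality under Dobrushin's condition, for the moment generating function. -/
theorem IsGibbsSystem.integral_exp_sub_le [IsProbabilityMeasure P] [Nonempty Z]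
    (h : IsGibbsSystem P K D) {α : ℝ} (hα : α < 1) (hrow : ∀ i, ∑ j, D i j ≤ α)
    {f : (ι → Z) → ℝ} (hf : BddMeas f) {c : ι → ℝ} (hc : OscBound f c) :
    ∫ x, Real.exp (f x - ∫ y, f y ∂P) ∂P ≤ Real.exp ((∑ i, c i ^ 2) / (1 - α) / 2) := by
  have hα' : 0 < 1 - α := by linarith
  -- A function that ignores every coordinate is constant.
  have hconst : ∀ ξ : (ι → Z) → ℝ, IndepOf ξ Finset.univ → ∀ x y, ξ x = ξ y := by
    intro ξ hξ x y
    have : ∀ T : Finset ι, ξ (T.piecewise y x) = ξ x := by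
      intro T
      induction T using Finset.induction_on with
      | empty => simp
      | insert a T _ ih => rw [Finset.piecewise_insert, hξ a (Finset.mem_univ a), ih]
    simpa using (this Finset.univ).symm
  have hr : ∀ i ∈ (Finset.univ : Finset ι),
      1 + ∑ k, D i k * (1 / (1 - α)) ≤ 1 / (1 - α) := by
    intro i _
    rw [← Finset.sum_mul]
    have h1 := mul_le_mul_of_nonneg_right (hrow i) (one_div_pos.2 hα').le
    have h2 : 1 / (1 - α) - α * (1 / (1 - α)) = 1 := by field_simp
    linarith
  have key := h.integral_mul_exp_le hα hrow hf hc Finset.univ (fun _ => 1 / (1 - α)) hr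
    (fun _ => ∫ y, f y ∂P) (BddMeas.const _) (fun _ _ _ _ => rfl)
    (fun ξ _ hξ => by
      obtain ⟨z⟩ := ‹Nonempty Z›
      have : ∀ x, ξ x = ξ fun _ => z := fun x => hconst ξ hξ _ _
      simp_rw [this]
      simp [integral_const_mul])
    (fun _ => 1) (BddMeas.const _) (fun _ _ _ _ => rfl) fun _ => zero_le_one
  simp only [one_mul, integral_const, probReal_univ, smul_eq_mul, ← Finset.mul_sum] at key
  simp_rw [Real.exp_sub]
  rw [integral_div, div_le_iff₀ (Real.exp_pos _), mul_comm]
  refine key.trans (le_of_eq ?_)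
  rw [one_div_mul_eq_div]

end Mgf

/-- McDiarmid's inequality under Dobrushin's condition: the upper quantiles of a function of
oscillations `c`. -/
theorem IsGibbsSystem.measureReal_lt_le {ι Z : Type*} [Fintype ι] [DecidableEq ι]
    [MeasurableSpace Z] [Nonempty Z] {P : Measure (ι → Z)} [IsProbabilityMeasure P]
    {K : ι → Kernel (ι → Z) Z} {D : ι → ι → ℝ} (h : IsGibbsSystem P K D) {α : ℝ} (hα : α < 1)
    (hrow : ∀ i, ∑ j, D i j ≤ α) {f : (ι → Z) → ℝ} (hf : BddMeas f) {c : ι → ℝ}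
    (hc : OscBound f c) {δ : ℝ} (hδ : 0 < δ) (hδ' : δ < 1) :
    P.real {x | Real.sqrt (2 * (∑ i, c i ^ 2) * Real.log (1 / δ) / (1 - α))
      < f x - ∫ y, f y ∂P} ≤ δ := by
  have hα' : 0 < 1 - α := by linarith
  have hsum : 0 ≤ ∑ i, c i ^ 2 := Finset.sum_nonneg fun i _ => sq_nonneg _
  have hlog : 0 < Real.log (1 / δ) := Real.log_pos (by rwa [lt_div_iff₀ hδ, one_mul])
  set v : NNReal := ⟨(∑ i, c i ^ 2) / (1 - α), div_nonneg hsum hα'.le⟩ with hv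
  have hvc : (v : ℝ) = (∑ i, c i ^ 2) / (1 - α) := rfl
  have hsub : HasSubgaussianMGF (fun x => f x - ∫ y, f y ∂P) v P := by
    refine ⟨fun t => ?_, fun t => ?_⟩
    · exact ((BddMeas.const t).mul (hf.sub (BddMeas.const _))).exp.integrable
    · have hct : OscBound (fun x => t * f x) fun i => |t| * c i := fun i x z => by
        rw [← mul_sub, abs_mul]
        exact mul_le_mul_of_nonneg_left (hc i x z) (abs_nonneg t)
      have key := h.integral_exp_sub_le hα hrow ((BddMeas.const t).mul hf) hct
      rw [integral_const_mul] at key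
      simp only [mul_pow, sq_abs, ← Finset.mul_sum] at key
      rw [mgf, hvc]
      simp_rw [mul_sub]
      refine key.trans (le_of_eq ?_)
      congr 1
      ring
  rcases eq_or_ne v 0 with h0 | h0
  · rw [h0] at hsub
    have hae := hsub.ae_eq_zero_of_hasSubgaussianMGF_zero
    have : P.real {x | Real.sqrt (2 * (∑ i, c i ^ 2) * Real.log (1 / δ) / (1 - α))
        < f x - ∫ y, f y ∂P} = 0 := by
      rw [measureReal_eq_zero_iff, measure_eq_zero_iff_ae_notMem]
      filter_upwards [hae] with x hx
      simp only [Pi.zero_apply] at hx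
      simp [hx, Real.sqrt_nonneg]
    rw [this]
    exact hδ.le
  · have hv0 : 0 < (v : ℝ) := NNReal.coe_pos.2 (pos_iff_ne_zero.2 h0)
    set ε := Real.sqrt (2 * (∑ i, c i ^ 2) * Real.log (1 / δ) / (1 - α))
    have hmono : {x | ε < f x - ∫ y, f y ∂P} ⊆ {x | ε ≤ f x - ∫ y, f y ∂P} :=
      fun x (hx : ε < _) => hx.le
    refine (measureReal_mono hmono).trans
      ((hsub.measure_ge_le (Real.sqrt_nonneg _)).trans (le_of_eq ?_))
    rw [Real.sq_sqrt (by positivity)]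
    have : -(2 * (∑ i, c i ^ 2) * Real.log (1 / δ) / (1 - α)) / (2 * v) = Real.log δ := by
      rw [show 2 * (∑ i, c i ^ 2) * Real.log (1 / δ) / (1 - α) = 2 * v * Real.log (1 / δ) by
        rw [hvc]; ring, one_div, Real.log_inv]
      field_simp
    rw [this, Real.exp_log hδ]

/-! ### Independent samples from a law satisfying Dobrushin's condition -/

lemma abs_measureReal_sub_le_tvDistance {Z : Type*} [MeasurableSpace Z] (P Q : Measure Z)
    [IsProbabilityMeasure P] [IsProbabilityMeasure Q] {A : Set Z} (hA : MeasurableSet A) :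
    |P.real A - Q.real A| ≤ tvDistance P Q := by
  refine le_csSup ⟨1, ?_⟩ ⟨A, hA, rfl⟩
  rintro _ ⟨A', -, rfl⟩
  rw [abs_le]
  constructor <;> linarith [measureReal_nonneg (μ := P) (s := A'),
    measureReal_nonneg (μ := Q) (s := A'), measureReal_le_one (μ := P) (s := A'),
    measureReal_le_one (μ := Q) (s := A')]

lemma tvDistance_le_one {Z : Type*} [MeasurableSpace Z] (P Q : Measure Z)
    [IsProbabilityMeasure P] [IsProbabilityMeasure Q] : tvDistance P Q ≤ 1 := by
  refine csSup_le ⟨_, ∅, MeasurableSet.empty, rfl⟩ ?_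
  rintro _ ⟨A', -, rfl⟩
  rw [abs_le]
  constructor <;> linarith [measureReal_nonneg (μ := P) (s := A'),
    measureReal_nonneg (μ := Q) (s := A'), measureReal_le_one (μ := P) (s := A'),
    measureReal_le_one (μ := Q) (s := A')]

lemma tvDistance_le_influence {V Z : Type*} [MeasurableSpace Z] {i : V}
    (κ : Kernel ({k : V // k ≠ i} → Z) Z) [IsMarkovKernel κ] {j : {k : V // k ≠ i}}
    {x y : {k : V // k ≠ i} → Z} (hxy : ∀ k, k ≠ j → x k = y k) :
    tvDistance (κ x) (κ y) ≤ influence κ j := by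
  refine le_csSup ⟨1, ?_⟩ ⟨x, y, hxy, rfl⟩
  rintro _ ⟨x', y', -, rfl⟩
  exact tvDistance_le_one _ _

/-- Drawing coordinate `i` afresh from its conditional law preserves the joint law. -/
lemma integral_resample_of_hasCondDistrib {V Z : Type*} [DecidableEq V] [MeasurableSpace Z]
    {D : Measure (V → Z)} [IsProbabilityMeasure D] {i : V}
    {κ : Kernel ({k : V // k ≠ i} → Z) Z} [IsMarkovKernel κ]
    (h : HasCondDistrib (fun z : V → Z => z i) (fun (z : V → Z) (k : {k : V // k ≠ i}) => z k) κ D)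
    {g : (V → Z) → ℝ} (hg : BddMeas g) :
    ∫ z, ∫ y, g (Function.update z i y) ∂κ (fun k => z k) ∂D = ∫ z, g z ∂D := by
  let e : ({k : V // k ≠ i} → Z) × Z → V → Z := fun p k => if hk : k = i then p.2 else p.1 ⟨k, hk⟩
  have he : Measurable e := by
    refine measurable_pi_iff.2 fun k => ?_
    by_cases hk : k = i
    · simp only [e, hk, dite_true]
      exact measurable_snd
    · simp only [e, hk, dite_false]
      exact (measurable_pi_apply _).comp measurable_fst
  have hrestr : Measurable fun (z : V → Z) (k : {k : V // k ≠ i}) => z k :=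
    measurable_pi_iff.2 fun k => measurable_pi_apply _
  have hge : BddMeas fun p => g (e p) := hg.comp he
  have hupd : ∀ (z : V → Z) (y : Z), e (fun k => z k, y) = Function.update z i y := by
    intro z y
    funext k
    by_cases hk : k = i
    · subst hk; simp [e]
    · simp [e, hk]
  have := Measure.isProbabilityMeasure_map (μ := D) hrestr.aemeasurable
  calc ∫ z, ∫ y, g (Function.update z i y) ∂κ (fun k => z k) ∂D
      = ∫ z, ∫ y, g (e (fun k => z k, y)) ∂κ (fun k => z k) ∂D := by simp_rw [hupd]
    _ = ∫ x, ∫ y, g (e (x, y)) ∂κ x ∂(D.map fun (z : V → Z) (k : {k : V // k ≠ i}) => z k) := by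
        rw [integral_map hrestr.aemeasurable]
        exact (hge.1.stronglyMeasurable.integral_kernel_prod_right'
          (κ := κ)).aestronglyMeasurable
    _ = ∫ p, g (e p) ∂((D.map fun (z : V → Z) (k : {k : V // k ≠ i}) => z k) ⊗ₘ κ) :=
        (Measure.integral_compProd hge.integrable).symm
    _ = ∫ z, g (e (fun k => z k, z i)) ∂D := by
        rw [← h.map_eq, integral_map (hrestr.prodMk (measurable_pi_apply i)).aemeasurable
          hge.1.aestronglyMeasurable]
    _ = ∫ z, g z ∂D := by simp_rw [hupd, Function.update_eq_self]

/-- Replacing one of several independent samples by a fresh one preserves the joint law. -/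
lemma map_update_pi_prod {τ Ω : Type*} [Fintype τ] [DecidableEq τ] [MeasurableSpace Ω]
    (D : Measure Ω) [IsProbabilityMeasure D] (s : τ) :
    ((Measure.pi fun _ : τ => D).prod D).map (fun p => Function.update p.1 s p.2)
      = Measure.pi fun _ : τ => D := by
  refine (Measure.pi_eq fun A hA => ?_).symm
  rw [Measure.map_apply measurable_update' (MeasurableSet.univ_pi hA)]
  have e : (fun p : (τ → Ω) × Ω => Function.update p.1 s p.2) ⁻¹' Set.univ.pi A
      = (Set.univ.pi (Function.update A s Set.univ)) ×ˢ A s := by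
    ext ⟨S, z⟩
    simp only [Set.mem_preimage, Set.mem_pi, Set.mem_univ, true_implies, Set.mem_prod]
    constructor
    · intro hS
      refine ⟨fun t => ?_, by simpa using hS s⟩
      by_cases ht : t = s
      · subst ht; simp
      · simpa [ht] using hS t
    · rintro ⟨hS, hz⟩ t
      by_cases ht : t = s
      · subst ht; simpa using hz
      · simpa [ht] using hS t
  rw [e, Measure.prod_prod, Measure.pi_pi, ← Finset.mul_prod_erase _ _ (Finset.mem_univ s),
    ← Finset.mul_prod_erase _ (fun i => D (A i)) (Finset.mem_univ s)]
  have e2 : ∏ t ∈ Finset.univ.erase s, D (Function.update A s Set.univ t)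
      = ∏ t ∈ Finset.univ.erase s, D (A t) :=
    Finset.prod_congr rfl fun t ht => by
      rw [Function.update_of_ne (Finset.ne_of_mem_erase ht)]
  rw [e2, Function.update_self, measure_univ, one_mul, mul_comm]

lemma integral_integral_update {τ Ω : Type*} [Fintype τ] [DecidableEq τ] [MeasurableSpace Ω]
    (D : Measure Ω) [IsProbabilityMeasure D] (s : τ) {G : (τ → Ω) → ℝ} (hG : BddMeas G) :
    ∫ S, ∫ z, G (Function.update S s z) ∂D ∂(Measure.pi fun _ : τ => D)
      = ∫ S, G S ∂(Measure.pi fun _ : τ => D) := by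
  conv_rhs => rw [← map_update_pi_prod D s]
  rw [integral_map measurable_update'.aemeasurable hG.1.aestronglyMeasurable,
    integral_prod _ (hG.comp measurable_update').integrable]

/-- The law of `τ`-many independent samples from `D`, with all coordinates listed in one family. -/
noncomputable def jointLaw (τ : Type*) [Fintype τ] {V Z : Type*} [MeasurableSpace Z]
    (D : Measure (V → Z)) : Measure (τ × V → Z) :=
  (Measure.pi fun _ : τ => D).map Function.uncurry

lemma measurable_uncurry_pi {τ V Z : Type*} [MeasurableSpace Z] :
    Measurable (Function.uncurry : (τ → V → Z) → τ × V → Z) :=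
  measurable_pi_iff.2 fun p => (measurable_pi_apply p.2).comp (measurable_pi_apply p.1)

lemma measurable_curry_pi {τ V Z : Type*} [MeasurableSpace Z] :
    Measurable (Function.curry : (τ × V → Z) → τ → V → Z) :=
  measurable_pi_iff.2 fun s => measurable_pi_iff.2 fun i => measurable_pi_apply (s, i)

lemma curry_update {τ V Z : Type*} [DecidableEq τ] [DecidableEq V] (x : τ × V → Z) (s : τ) (i : V)
    (y : Z) : Function.curry (Function.update x (s, i) y)
      = Function.update (Function.curry x) s
          (Function.update (Function.curry x s) i y) := by
  funext t k
  by_cases ht : t = s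
  · subst ht
    by_cases hk : k = i
    · subst hk; simp [Function.curry]
    · simp [Function.curry, hk]
  · simp [Function.curry, ht]

/-- Independent samples from a law satisfying Dobrushin's condition form a Gibbs system with the
same bound on the row sums: there is no influence between different samples. -/
lemma DobrushinCondition.exists_isGibbsSystem {V Z : Type*} [Fintype V] [DecidableEq V]
    [MeasurableSpace Z] {D : Measure (V → Z)} [IsProbabilityMeasure D] {α : ℝ}
    (hD : DobrushinCondition D α) (τ : Type*) [Fintype τ] [DecidableEq τ] :
    ∃ (K : τ × V → Kernel (τ × V → Z) Z) (I : τ × V → τ × V → ℝ),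
      IsGibbsSystem (jointLaw τ D) K I ∧ ∀ p, ∑ q, I p q ≤ α := by
  obtain ⟨-, κ, hκ, hcond, hsum⟩ := hD
  have hres : ∀ p : τ × V, Measurable fun (x : τ × V → Z) (k : {k : V // k ≠ p.2}) => x (p.1, k) :=
    fun p => measurable_pi_iff.2 fun k => measurable_pi_apply _
  refine ⟨fun p => (κ p.2).comap _ (hres p), fun p q =>
    if h : q.1 = p.1 ∧ q.2 ≠ p.2 then influence (κ p.2) ⟨q.2, h.2⟩ else 0,
    ⟨fun p => ?_, ?_, ?_, ?_⟩, ?_⟩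
  · have := hκ p.2
    infer_instance
  · rintro ⟨s, i⟩ x z
    simp only [Kernel.comap_apply]
    congr 1
    funext k
    have : ((s, (k : V)) : τ × V) ≠ (s, i) := fun h => k.2 (congrArg Prod.snd h)
    rw [Function.update_of_ne this]
  · rintro ⟨s, i⟩ ⟨t, j⟩ x z A hA
    have := hκ i
    simp only [Kernel.comap_apply]
    split_ifs with h
    · obtain ⟨rfl, hji⟩ := h
      refine (abs_measureReal_sub_le_tvDistance _ _ hA).trans
        (tvDistance_le_influence (κ i) (j := ⟨j, hji⟩) fun k hk => ?_)
      have : ((t, (k : V)) : τ × V) ≠ (t, j) := fun h => hk (Subtype.ext (congrArg Prod.snd h))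
      rw [Function.update_of_ne this]
    · have e : (fun k : {k : V // k ≠ i} => Function.update x (t, j) z (s, (k : V)))
          = fun k : {k : V // k ≠ i} => x (s, (k : V)) := by
        funext k
        refine Function.update_of_ne (fun hk => h ?_) _ _
        simp only [Prod.mk.injEq] at hk
        exact ⟨hk.1.symm, hk.2 ▸ k.2⟩
      rw [e]
      simp
  · rintro ⟨s, i⟩ g hgm hgC
    have := hκ i
    have hg : BddMeas g := ⟨hgm, hgC⟩
    set G : (τ → V → Z) → ℝ := fun S => g (Function.uncurry S) with hG
    have hGb : BddMeas G := hg.comp measurable_uncurry_pi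
    have hgG : ∀ x, g x = G (Function.curry x) := fun x => by simp [hG]
    simp only [Kernel.comap_apply]
    set H : (τ → V → Z) → ℝ := fun S =>
      ∫ y, G (Function.update S s (Function.update (S s) i y)) ∂κ i (fun k => S s k) with hH
    have hHb : BddMeas H := by
      have hm : Measurable fun p : (τ → V → Z) × Z =>
          G (Function.update p.1 s (Function.update (p.1 s) i p.2)) := by
        refine hGb.1.comp (measurable_update'.comp (measurable_fst.prodMk ?_))
        have h2 : Measurable fun p : (τ → V → Z) × Z => (p.1 s, p.2) :=
          ((measurable_pi_apply s).comp measurable_fst).prodMk measurable_snd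
        exact (measurable_update' (X := fun _ : V => Z) (a := i)).comp h2
      have hr : Measurable fun (S : τ → V → Z) (k : {k : V // k ≠ i}) => S s k :=
        measurable_pi_iff.2 fun k => (measurable_pi_apply (k : V)).comp (measurable_pi_apply s)
      obtain ⟨C, hC⟩ := hGb.2
      refine ⟨(hm.stronglyMeasurable.integral_kernel_prod_right'
        (κ := (κ i).comap _ hr)).measurable, C, fun S => ?_⟩
      have := norm_integral_le_of_norm_le_const (μ := κ i (fun k => S s k))
        (f := fun y => G (Function.update S s (Function.update (S s) i y))) (C := C)
        (Filter.Eventually.of_forall fun y => hC _)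
      simpa [hH] using this
    have hxH : ∀ x : τ × V → Z,
        ∫ z, g (Function.update x (s, i) z) ∂κ i (fun k => x (s, (k : V)))
          = H (Function.curry x) := by
      intro x
      simp only [hH, hgG, curry_update]
      rfl
    simp_rw [hxH]
    rw [jointLaw, integral_map measurable_uncurry_pi.aemeasurable
      (hHb.comp measurable_curry_pi).1.aestronglyMeasurable,
      integral_map measurable_uncurry_pi.aemeasurable hgm.aestronglyMeasurable]
    simp only [Function.curry_uncurry]
    rw [← integral_integral_update D s hHb, ← integral_integral_update D s hGb]
    refine integral_congr_ae (Filter.Eventually.of_forall fun S => ?_)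
    have := integral_resample_of_hasCondDistrib (hcond i)
      (hGb.comp (measurable_update S : Measurable (Function.update S s)))
    simp only [hH, Function.update_self, Function.update_idem]
    exact this
  · rintro ⟨s, i⟩
    rw [Fintype.sum_prod_type, Finset.sum_eq_single s]
    · refine le_trans (le_of_eq ?_) (hsum i)
      symm
      refine @Fintype.sum_of_injective _ _ _ (_) _ _ (fun k : {k : V // k ≠ i} => (k : V))
        Subtype.val_injective _ _ (fun k hk => ?_) fun k => ?_
      · have : k = i := by
          by_contra hki
          exact hk ⟨⟨k, hki⟩, rfl⟩
        simp [this]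
      · have := k.2
        simp [this]
    · intro t _ ht
      simp [ht]
    · simp

/-! ### The generalization gap of a stable algorithm -/

lemma mem_nbhd_comm {V : Type*} [Fintype V] (G : SimpleGraph V) {i j : V} :
    i ∈ nbhd G j ↔ j ∈ nbhd G i := by
  simp only [nbhd, Finset.mem_filter, Finset.mem_univ, true_and, G.adj_comm, eq_comm]

/-- The loss at a vertex `j` outside the neighbourhood of `i` does not see the data at `i`. -/
lemma nodeLoss_congr {V X Y W : Type*} [Fintype V] (G : SimpleGraph V) (L : W → Y → ℝ)
    (h : Hypothesis G X W) {z z' : V → X × Y} {j : V} (hz : ∀ k ∈ nbhd G j, z k = z' k) :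
    nodeLoss G L h z j = nodeLoss G L h z' j := by
  have h1 : nodeInput G z j = nodeInput G z' j := by
    funext k
    simp only [nodeInput, hz k k.2]
  have h2 : z j = z' j := hz j (by simp [nbhd])
  rw [nodeLoss, nodeLoss, h1, h2]

lemma graphRisk_sub_le {V X Y W : Type*} [Fintype V] [Nonempty V] (G : SimpleGraph V)
    (L : W → Y → ℝ) {h h' : Hypothesis G X W} {z : V → X × Y} {b : ℝ}
    (hb : ∀ j, |nodeLoss G L h z j - nodeLoss G L h' z j| ≤ b) :
    |graphRisk G L h z - graphRisk G L h' z| ≤ b := by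
  have hN : (0 : ℝ) < Fintype.card V := by exact_mod_cast Fintype.card_pos
  rw [graphRisk, graphRisk, ← mul_sub, ← Finset.sum_sub_distrib, abs_mul,
    abs_of_pos (one_div_pos.2 hN), one_div_mul_eq_div, div_le_iff₀ hN]
  refine (Finset.abs_sum_le_sum_abs _ _).trans ((Finset.sum_le_sum fun j _ => hb j).trans ?_)
  simp [mul_comm]

lemma abs_graphRisk_le {V X Y W : Type*} [Fintype V] [Nonempty V] (G : SimpleGraph V)
    {L : W → Y → ℝ} {B : ℝ} (hL : ∀ w y, 0 ≤ L w y ∧ L w y ≤ B) (h : Hypothesis G X W)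
    (z : V → X × Y) : |graphRisk G L h z| ≤ B := by
  have hN : (0 : ℝ) < Fintype.card V := by exact_mod_cast Fintype.card_pos
  rw [graphRisk, abs_mul, abs_of_pos (one_div_pos.2 hN), one_div_mul_eq_div, div_le_iff₀ hN]
  refine (Finset.abs_sum_le_sum_abs _ _).trans ((Finset.sum_le_sum fun j _ =>
    show |nodeLoss G L h z j| ≤ B from ?_).trans ?_)
  · rw [nodeLoss, abs_of_nonneg (hL _ _).1]
    exact (hL _ _).2
  · simp [mul_comm]

/-- Replacing a whole sample changes the losses by at most `μ` per vertex. -/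
lemma UniformlyStable.abs_sub_le_of_update {V X Y W : Type*} [Fintype V] {G : SimpleGraph V}
    {L : W → Y → ℝ} {m : ℕ} {A : Algorithm G X Y W m} {μ : ℝ} (hμ : UniformlyStable G L A μ)
    (S : Fin m → V → X × Y) (s : Fin m) (z w : V → X × Y) (j : V) :
    |nodeLoss G L (A (Function.update S s z)) w j - nodeLoss G L (A S) w j|
      ≤ (Fintype.card V : ℝ) * μ := by
  classical
  have key : ∀ T : Finset V,
      |nodeLoss G L (A (Function.update S s (T.piecewise z (S s)))) w j - nodeLoss G L (A S) w j|
        ≤ (T.card : ℝ) * μ := by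
    intro T
    induction T using Finset.induction_on with
    | empty => simp
    | insert a T ha ih =>
      rw [Finset.card_insert_of_notMem ha]
      have h1 := hμ (Function.update S s ((insert a T).piecewise z (S s)))
        (Function.update S s (T.piecewise z (S s))) s a (fun i k hik => by
          by_cases hi : i = s
          · subst hi
            have hk : k ≠ a := fun e => hik ⟨rfl, e⟩
            simp only [Function.update_self]
            rw [Finset.piecewise_insert, Function.update_of_ne hk]
          · simp [hi]) w j
      have h2 := abs_sub_le (nodeLoss G L (A (Function.update S s
        ((insert a T).piecewise z (S s)))) w j) (nodeLoss G L (A (Function.update S s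
        (T.piecewise z (S s)))) w j) (nodeLoss G L (A S) w j)
      push_cast
      linarith
  simpa using key Finset.univ

section Gap

variable {V X Y W : Type*} [Fintype V] [Nonempty V] [MeasurableSpace X] [MeasurableSpace Y]
  {G : SimpleGraph V} {L : W → Y → ℝ} {B : ℝ} {D : Measure (V → X × Y)} [IsProbabilityMeasure D]
  {m : ℕ} {A : Algorithm G X Y W m} {μ : ℝ}

lemma bddMeas_graphRisk (hL : ∀ w y, 0 ≤ L w y ∧ L w y ≤ B)
    (hA : ∀ j : V, Measurable fun p : (Fin m → V → X × Y) × (V → X × Y) =>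
      nodeLoss G L (A p.1) p.2 j) :
    BddMeas fun p : (Fin m → V → X × Y) × (V → X × Y) => graphRisk G L (A p.1) p.2 :=
  ⟨(Finset.measurable_sum _ fun j _ => hA j).const_mul _, B,
    fun _ => abs_graphRisk_le G hL _ _⟩

lemma bddMeas_risk (hL : ∀ w y, 0 ≤ L w y ∧ L w y ≤ B)
    (hA : ∀ j : V, Measurable fun p : (Fin m → V → X × Y) × (V → X × Y) =>
      nodeLoss G L (A p.1) p.2 j) :
    BddMeas fun S => risk G L D (A S) := by
  refine ⟨((bddMeas_graphRisk hL hA).1.stronglyMeasurable.integral_prod_right'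
    (ν := D)).measurable, B, fun S => ?_⟩
  have := norm_integral_le_of_norm_le_const (μ := D) (f := fun z => graphRisk G L (A S) z) (C := B)
    (Filter.Eventually.of_forall fun z => abs_graphRisk_le G hL _ _)
  simpa [risk] using this

lemma bddMeas_gap (hL : ∀ w y, 0 ≤ L w y ∧ L w y ≤ B)
    (hA : ∀ j : V, Measurable fun p : (Fin m → V → X × Y) × (V → X × Y) =>
      nodeLoss G L (A p.1) p.2 j) :
    BddMeas fun S => risk G L D (A S) - empiricalRisk G L (A S) S := by
  refine (bddMeas_risk hL hA).sub ⟨?_, |1 / (m : ℝ)| * (m * B), fun S => ?_⟩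
  · refine (Finset.measurable_sum _ fun i _ => ?_).const_mul _
    exact (bddMeas_graphRisk hL hA).1.comp (measurable_id.prodMk (measurable_pi_apply i))
  · change |1 / (m : ℝ) * ∑ i, graphRisk G L (A S) (S i)| ≤ _
    rw [abs_mul]
    refine mul_le_mul_of_nonneg_left ?_ (abs_nonneg _)
    refine (Finset.abs_sum_le_sum_abs _ _).trans
      ((Finset.sum_le_sum fun i _ => abs_graphRisk_le G hL _ _).trans ?_)
    simp

/-- The expected gap. Exchanging the `i`-th sample for a fresh one turns the empirical risk on it
into the risk on a fresh sample, up to the effect of the exchange on the algorithm. -/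
lemma abs_integral_gap_le (hL : ∀ w y, 0 ≤ L w y ∧ L w y ≤ B) (hm : 1 ≤ m)
    (hA : ∀ j : V, Measurable fun p : (Fin m → V → X × Y) × (V → X × Y) =>
      nodeLoss G L (A p.1) p.2 j)
    (hμ : UniformlyStable G L A μ) :
    |∫ S, (risk G L D (A S) - empiricalRisk G L (A S) S) ∂(Measure.pi fun _ : Fin m => D)|
      ≤ (Fintype.card V : ℝ) * μ := by
  have hm0 : (0 : ℝ) < m := by exact_mod_cast hm
  have hgr := bddMeas_graphRisk hL hA
  have hR : BddMeas fun S => risk G L D (A S) := bddMeas_risk hL hA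
  have hS : ∀ i, BddMeas fun S : Fin m → V → X × Y => graphRisk G L (A S) (S i) := fun i =>
    hgr.comp (measurable_id.prodMk (measurable_pi_apply i))
  set Q := Measure.pi fun _ : Fin m => D with hQ
  have hone : ∀ i, |∫ S, (risk G L D (A S) - graphRisk G L (A S) (S i)) ∂Q|
      ≤ (Fintype.card V : ℝ) * μ := by
    intro i
    have hswap : ∀ S z, graphRisk G L (A (Function.update S i z)) (Function.update S i z i)
        = graphRisk G L (A (Function.update S i z)) z := fun S z => by rw [Function.update_self]
    have hH : BddMeas fun p : (Fin m → V → X × Y) × (V → X × Y) =>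
        graphRisk G L (A (Function.update p.1 i p.2)) p.2 :=
      hgr.comp (measurable_update'.prodMk measurable_snd)
    have e : ∫ S, (risk G L D (A S) - graphRisk G L (A S) (S i)) ∂Q
        = ∫ p, (graphRisk G L (A p.1) p.2 - graphRisk G L (A (Function.update p.1 i p.2)) p.2)
            ∂(Q.prod D) := by
      rw [integral_sub hR.integrable (hS i).integrable, integral_sub hgr.integrable hH.integrable,
        integral_prod _ hgr.integrable, integral_prod _ hH.integrable,
        ← integral_integral_update D i (hS i)]
      simp_rw [hswap]
      rfl
    rw [e]
    have := norm_integral_le_of_norm_le_const (μ := Q.prod D)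
      (f := fun p => graphRisk G L (A p.1) p.2 - graphRisk G L (A (Function.update p.1 i p.2)) p.2)
      (C := (Fintype.card V : ℝ) * μ) (Filter.Eventually.of_forall fun p => by
        rw [Real.norm_eq_abs, abs_sub_comm]
        exact graphRisk_sub_le G L fun j => hμ.abs_sub_le_of_update p.1 i p.2 p.2 j)
    simpa using this
  have e : ∀ S, risk G L D (A S) - empiricalRisk G L (A S) S
      = (1 / (m : ℝ)) * ∑ i, (risk G L D (A S) - graphRisk G L (A S) (S i)) := by
    intro S
    rw [Finset.sum_sub_distrib, empiricalRisk]
    simp only [Finset.sum_const, Finset.card_univ, Fintype.card_fin, nsmul_eq_mul]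
    field_simp
  simp_rw [e]
  rw [integral_const_mul, integral_finsetSum _ fun i _ => (hR.sub (hS i)).integrable, abs_mul,
    abs_of_pos (one_div_pos.2 hm0), one_div_mul_eq_div, div_le_iff₀ hm0]
  refine (Finset.abs_sum_le_sum_abs _ _).trans ((Finset.sum_le_sum fun i _ => hone i).trans ?_)
  simp [mul_comm]

/-- Changing the data at vertex `i` of sample `s` moves the risk by at most `μ`; in the empirical
risk, the losses at the neighbourhood of `i` in sample `s` change by at most `B` and all others by
at most `μ`. -/
lemma abs_gap_update_sub_le [DecidableEq V] (hL : ∀ w y, 0 ≤ L w y ∧ L w y ≤ B) (hm : 1 ≤ m)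
    (hA : ∀ j : V, Measurable fun p : (Fin m → V → X × Y) × (V → X × Y) =>
      nodeLoss G L (A p.1) p.2 j)
    (hμ : UniformlyStable G L A μ) (S : Fin m → V → X × Y) (s : Fin m) (i : V) (y : X × Y) :
    let S' := Function.update S s (Function.update (S s) i y)
    |(risk G L D (A S') - empiricalRisk G L (A S') S')
        - (risk G L D (A S) - empiricalRisk G L (A S) S)|
      ≤ (2 - nbhdDensity G i / m) * μ + nbhdCard G i * B / (m * (Fintype.card V : ℝ)) := by
  intro S'
  have hm0 : (0 : ℝ) < m := by exact_mod_cast hm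
  have hN : (0 : ℝ) < Fintype.card V := by exact_mod_cast Fintype.card_pos
  have hst : ∀ w j, |nodeLoss G L (A S') w j - nodeLoss G L (A S) w j| ≤ μ := by
    refine hμ S' S s i fun t k htk => ?_
    by_cases ht : t = s
    · subst ht
      have hk : k ≠ i := fun e => htk ⟨rfl, e⟩
      simp [S', hk]
    · simp [S', ht]
  have hrisk : |risk G L D (A S') - risk G L D (A S)| ≤ μ := by
    have hi : ∀ S, Integrable (fun z => graphRisk G L (A S) z) D := fun S =>
      ((bddMeas_graphRisk hL hA).comp (measurable_prodMk_left (x := S))).integrable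
    rw [risk, risk, ← integral_sub (hi _) (hi _)]
    have := norm_integral_le_of_norm_le_const (μ := D)
      (f := fun z => graphRisk G L (A S') z - graphRisk G L (A S) z) (C := μ)
      (Filter.Eventually.of_forall fun z => graphRisk_sub_le G L fun j => hst z j)
    simpa using this
  have hnode : ∀ t j, |nodeLoss G L (A S') (S' t) j - nodeLoss G L (A S) (S t) j|
      ≤ μ + if t = s then (if j ∈ nbhd G i then B - μ else 0) else 0 := by
    intro t j
    by_cases h : t = s ∧ j ∈ nbhd G i
    · rw [if_pos h.1, if_pos h.2, nodeLoss, nodeLoss, abs_le]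
      have h1 := hL (A S' j (nodeInput G (S' t) j)) (S' t j).2
      have h2 := hL (A S j (nodeInput G (S t) j)) (S t j).2
      constructor <;> linarith [h1.1, h1.2, h2.1, h2.2]
    · have h0 : (if t = s then (if j ∈ nbhd G i then B - μ else 0) else 0) = 0 := by
        split_ifs with h1 h2
        · exact absurd ⟨h1, h2⟩ h
        · rfl
        · rfl
      rw [h0, add_zero, nodeLoss_congr G L (A S) (z := S t) (z' := S' t)]
      · exact hst _ _
      · intro k hk
        by_cases ht : t = s
        · subst ht
          have hki : k ≠ i := fun e => h ⟨rfl, (mem_nbhd_comm G).1 (e ▸ hk)⟩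
          simp [S', hki]
        · simp [S', ht]
  have hemp : |empiricalRisk G L (A S') S' - empiricalRisk G L (A S) S|
      ≤ (1 / (m : ℝ)) * ((1 / (Fintype.card V : ℝ)) *
        (m * Fintype.card V * μ + nbhdCard G i * (B - μ))) := by
    have e : empiricalRisk G L (A S') S' - empiricalRisk G L (A S) S
        = (1 / (m : ℝ)) * ((1 / (Fintype.card V : ℝ)) * ∑ t, ∑ j,
          (nodeLoss G L (A S') (S' t) j - nodeLoss G L (A S) (S t) j)) := by
      simp only [empiricalRisk, graphRisk, ← Finset.mul_sum, Finset.sum_sub_distrib]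
      ring
    rw [e, abs_mul, abs_mul, abs_of_pos (one_div_pos.2 hm0), abs_of_pos (one_div_pos.2 hN)]
    refine mul_le_mul_of_nonneg_left (mul_le_mul_of_nonneg_left ?_ (one_div_pos.2 hN).le)
      (one_div_pos.2 hm0).le
    refine (Finset.abs_sum_le_sum_abs _ _).trans ((Finset.sum_le_sum fun t _ =>
      (Finset.abs_sum_le_sum_abs _ _).trans (Finset.sum_le_sum fun j _ => hnode t j)).trans ?_)
    simp only [Finset.sum_add_distrib, Finset.sum_const, Finset.card_univ, Fintype.card_fin,
      nsmul_eq_mul]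
    rw [Finset.sum_eq_single s (fun t _ ht => by simp [ht]) (by simp)]
    simp only [if_true, Finset.sum_ite_mem, Finset.univ_inter, Finset.sum_const, nsmul_eq_mul,
      nbhdCard]
    linarith
  have htri : |(risk G L D (A S') - empiricalRisk G L (A S') S')
        - (risk G L D (A S) - empiricalRisk G L (A S) S)|
      ≤ |risk G L D (A S') - risk G L D (A S)|
        + |empiricalRisk G L (A S') S' - empiricalRisk G L (A S) S| := by
    rw [show (risk G L D (A S') - empiricalRisk G L (A S') S')
        - (risk G L D (A S) - empiricalRisk G L (A S) S)
      = (risk G L D (A S') - risk G L D (A S))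
        - (empiricalRisk G L (A S') S' - empiricalRisk G L (A S) S) by ring]
    exact abs_sub _ _
  refine htri.trans ((add_le_add hrisk hemp).trans (le_of_eq ?_))
  rw [nbhdDensity]
  field_simp
  ring

end Gap

/-- A bounded measurable function `f` of `m` independent samples whose mean is at most `b` and whose
change at vertex `i` of any sample is at most `c i` exceeds `b` by the stated amount with
probability at most `δ`. -/
lemma DobrushinCondition.le_measureReal_pi {V Z : Type*} [Fintype V] [DecidableEq V]
    [MeasurableSpace Z] [Nonempty Z] {D : Measure (V → Z)} [IsProbabilityMeasure D] {α : ℝ}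
    (hD : DobrushinCondition D α) {m : ℕ} {f : (Fin m → V → Z) → ℝ} (hf : BddMeas f) {c : V → ℝ}
    (hc : ∀ S s i y, |f (Function.update S s (Function.update (S s) i y)) - f S| ≤ c i) {b : ℝ}
    (hb : ∫ S, f S ∂(Measure.pi fun _ : Fin m => D) ≤ b) {δ : ℝ} (hδ : 0 < δ) (hδ' : δ < 1) :
    1 - δ ≤ (Measure.pi fun _ : Fin m => D).real
      {S | f S ≤ b + Real.sqrt (2 * m * (∑ i, c i ^ 2) * Real.log (1 / δ) / (1 - α))} := by
  obtain ⟨K, I, hK, hI⟩ := hD.exists_isGibbsSystem (Fin m)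
  set Q := Measure.pi fun _ : Fin m => D with hQ
  have : IsProbabilityMeasure (jointLaw (Fin m) D) :=
    Measure.isProbabilityMeasure_map measurable_uncurry_pi.aemeasurable
  have hfc : BddMeas fun x : Fin m × V → Z => f (Function.curry x) := hf.comp measurable_curry_pi
  have hosc : OscBound (fun x : Fin m × V → Z => f (Function.curry x)) fun p => c p.2 := by
    rintro ⟨s, i⟩ x z
    simp only [curry_update]
    exact hc (Function.curry x) s i z
  have key := hK.measureReal_lt_le hD.1 hI hfc hosc hδ hδ'
  have hint : ∫ x, f (Function.curry x) ∂(jointLaw (Fin m) D) = ∫ S, f S ∂Q := by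
    rw [jointLaw, integral_map measurable_uncurry_pi.aemeasurable hfc.1.aestronglyMeasurable]
    simp only [Function.curry_uncurry]
    rfl
  have hsum : ∑ p : Fin m × V, c p.2 ^ 2 = m * ∑ i, c i ^ 2 := by
    rw [Fintype.sum_prod_type]
    simp
  rw [hint, hsum, ← mul_assoc] at key
  set t := Real.sqrt (2 * m * (∑ i, c i ^ 2) * Real.log (1 / δ) / (1 - α)) with ht
  have hmeas : MeasurableSet {S | f S ≤ b + t} := measurableSet_le hf.1 measurable_const
  rw [jointLaw, map_measureReal_apply measurable_uncurry_pi
    (measurableSet_lt measurable_const (hfc.1.sub_const _))] at key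
  have hcompl : Q.real {S | f S ≤ b + t}ᶜ ≤ δ := by
    refine (measureReal_mono fun S hS => ?_).trans key
    simp only [Set.mem_compl_iff, Set.mem_ofPred_eq, not_le] at hS
    simp only [Set.mem_preimage, Set.mem_ofPred_eq, Function.curry_uncurry]
    linarith
  have := probReal_compl_eq_one_sub (μ := Q) hmeas
  linarith

theorem theorem2 {V X Y W : Type*} [Fintype V] [Nonempty V]
    [MeasurableSpace X] [MeasurableSpace Y]
    (G : SimpleGraph V) (L : W → Y → ℝ) (B : ℝ) (hL : ∀ w y, 0 ≤ L w y ∧ L w y ≤ B)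
    (D : Measure (V → X × Y)) [IsProbabilityMeasure D]
    (α : ℝ) (hD : DobrushinCondition D α)
    (m : ℕ) (hm : 1 ≤ m) (A : Algorithm G X Y W m)
    (hA : ∀ j : V, Measurable fun p : (Fin m → V → X × Y) × (V → X × Y) =>
      nodeLoss G L (A p.1) p.2 j)
    (μ : ℝ) (hμ : UniformlyStable G L A μ)
    (δ : ℝ) (hδ : 0 < δ) (hδ' : δ < 1) :
    (1 - δ ≤ (Measure.pi fun _ : Fin m => D).real
      {S | risk G L D (A S) - empiricalRisk G L (A S) S
        ≤ (Fintype.card V : ℝ) * μ + deviation G m μ B α δ}) ∧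
    (1 - δ ≤ (Measure.pi fun _ : Fin m => D).real
      {S | empiricalRisk G L (A S) S - risk G L D (A S)
        ≤ (Fintype.card V : ℝ) * μ + deviation G m μ B α δ}) := by
  classical
  obtain ⟨z⟩ : Nonempty (V → X × Y) := nonempty_of_isProbabilityMeasure D
  have : Nonempty (X × Y) := ⟨z (Classical.arbitrary V)⟩
  have hgap := bddMeas_gap (D := D) hL hA
  have hosc := abs_gap_update_sub_le (D := D) hL hm hA hμ
  have hmean := abs_le.1 (abs_integral_gap_le (D := D) hL hm hA hμ)
  refine ⟨hD.le_measureReal_pi hgap hosc hmean.2 hδ hδ', ?_⟩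
  have hneg : ∀ S, empiricalRisk G L (A S) S - risk G L D (A S)
      = 0 - (risk G L D (A S) - empiricalRisk G L (A S) S) := fun S => by ring
  simp_rw [hneg]
  refine hD.le_measureReal_pi ((BddMeas.const 0).sub hgap) (fun S s i y => ?_) ?_ hδ hδ'
  · rw [sub_sub_sub_cancel_left, abs_sub_comm]
    exact hosc S s i y
  · rw [integral_sub (integrable_const _) hgap.integrable]
    simp only [integral_zero]
    linarith [hmean.1]
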